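/- Let $G$ be a compact Lie group, let $B$ be a smooth (finite-dimensional, Hausdorff, boundaryless) manifold with a smooth $G$-action, and let $\pi:E\to B$ be a smooth real $G$-vector bundle of finite rank, i.e. a smooth vector bundle with a smooth $G$-action on $E$ such that $\pi$ is equivariant and each $g\in G$ maps $E_x$ linearly to $E_{gx}$. For $x\in B$ let $G_x=\{g\in G: gx=x\}$ and let $E_x^f=\{v\in E_x : gv=v \text{ for all } g\in G_x\}$. For a closed subgroup $H\subseteq G$ let $B_{(H)}=\{x\in B : G_x \text{ is conjugate to } H \text{ in } G\}$. Then: 1. If $x$ and $y$ lie in the same connected component of $B_{(H)}$, then $\dim E_x^f=\dim E_y^f$. 2. $B_{(H)}$ is a $G$-invariant embedded smooth submanifold of $B$ (whose components may have different dimensions), and the fixed spaces $E_x^f$, $x\in B_{(H)}$, form a smooth $G$-vector subbundle $\mathcal E_H$ of $E|_{B_{(H)}}$: it is $G$-invariant, and near each point of $B_{(H)}$ there is a smooth local trivialization of $E$ carrying all the fixed spaces $E_y^f$, for $y\in B_{(H)}$ in its domain, onto one fixed linear subspace of the model fibre. 3. The quotient bundle $\mathcal O_H=E|_{B_{(H)}}/\mathcal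 E_H$ (the obstruction bundle), with fibres $E_x/E_x^f$ and the induced $G$-action, is a complement of $\mathcal E_H$: the quotient map $E|_{B_{(H)}}\to\mathcal O_H$ has a $G$-equivariant fibrewise linear splitting whose image is a smooth $G$-vector subbundle of $E|_{B_{(H)}}$ complementary to $\mathcal E_H$ in every fibre, so that $E|_{B_{(H)}}=\mathcal E_H\oplus\mathcal O_H$ as smooth $G$-vector bundles. -/

import Mathlib

open Bundle Module
open scoped Manifold ContDiff

/-! ### Equivariant vector bundles -/

/-- The action of `G` on the total space of `E → B` covers the action of `G` on `B` and is linear on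
the fibres: every `g` maps the fibre `E x` linearly into the fibre `E (g • x)`. In particular the
projection is equivariant. Together with smoothness of both actions this makes `E → B` a smooth
`G`-vector bundle. -/
class IsFiberwiseLinearAction (G : Type*) {B : Type*} (F : Type*) (E : B → Type*)
    [Group G] [MulAction G B] [MulAction G (TotalSpace F E)]
    [∀ x, AddCommGroup (E x)] [∀ x, Module ℝ (E x)] : Prop where
  exists_linearMap : ∀ (g : G) (x : B), ∃ A : E x →ₗ[ℝ] E (g • x),
    ∀ v : E x, g • (⟨x, v⟩ : TotalSpace F E) = ⟨g • x, A v⟩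

section Algebra

variable (G : Type*) {B : Type*} (F : Type*) (E : B → Type*)
  [Group G] [MulAction G B] [MulAction G (TotalSpace F E)]
  [∀ x, AddCommGroup (E x)] [∀ x, Module ℝ (E x)] [IsFiberwiseLinearAction G F E]

variable {G} in
/-- The linear map `g : E x → E (g • x)` between fibres induced by the action on `E`. -/
noncomputable def fiberAction (g : G) (x : B) : E x →ₗ[ℝ] E (g • x) :=
  Classical.choose (IsFiberwiseLinearAction.exists_linearMap (F := F) (E := E) g x)

variable {G} in
theorem smul_mk_eq_fiberAction (g : G) (x : B) (v : E x) :
    g • (⟨x, v⟩ : TotalSpace F E) = ⟨g • x, fiberAction F E g x v⟩ :=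
  Classical.choose_spec (IsFiberwiseLinearAction.exists_linearMap (F := F) (E := E) g x) v

variable {G F E} in
theorem exists_linearMap_of_smul_eq {g : G} {x y : B} (h : g • x = y) :
    ∃ A : E x →ₗ[ℝ] E y, ∀ v : E x, g • (⟨x, v⟩ : TotalSpace F E) = ⟨y, A v⟩ := by
  subst h
  exact IsFiberwiseLinearAction.exists_linearMap g x

/-- The subspace of the fibre `E x` fixed by the isotropy group of `x`. -/
def fixedSubspace (x : B) : Submodule ℝ (E x) where
  carrier := {v | ∀ g ∈ MulAction.stabilizer G x,
    g • (⟨x, v⟩ : TotalSpace F E) = ⟨x, v⟩}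
  zero_mem' := by
    intro g hg
    obtain ⟨A, hA⟩ := exists_linearMap_of_smul_eq (F := F) (E := E) (MulAction.mem_stabilizer_iff.1 hg)
    rw [hA, map_zero]
  add_mem' := by
    intro v w hv hw g hg
    obtain ⟨A, hA⟩ := exists_linearMap_of_smul_eq (F := F) (E := E) (MulAction.mem_stabilizer_iff.1 hg)
    have h1 := hv g hg
    have h2 := hw g hg
    rw [hA] at h1 h2 ⊢
    have h1' : A v = v := by simpa using h1
    have h2' : A w = w := by simpa using h2
    rw [map_add, h1', h2']
  smul_mem' := by
    intro c v hv g hg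
    obtain ⟨A, hA⟩ := exists_linearMap_of_smul_eq (F := F) (E := E) (MulAction.mem_stabilizer_iff.1 hg)
    have h1 := hv g hg
    rw [hA] at h1 ⊢
    have h1' : A v = v := by simpa using h1
    rw [map_smul, h1']

variable {G E} in
theorem mem_fixedSubspace_iff {x : B} {v : E x} :
    v ∈ fixedSubspace G F E x ↔
      ∀ g ∈ MulAction.stabilizer G x, g • (⟨x, v⟩ : TotalSpace F E) = ⟨x, v⟩ :=
  Iff.rfl

/-- The action maps fixed subspaces into fixed subspaces. -/
theorem fixedSubspace_le_comap (g : G) (x : B) :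
    fixedSubspace G F E x ≤ (fixedSubspace G F E (g • x)).comap (fiberAction F E g x) := by
  intro v hv
  rw [Submodule.mem_comap, mem_fixedSubspace_iff]
  intro h hh
  have hk : g⁻¹ * h * g ∈ MulAction.stabilizer G x := by
    rw [MulAction.mem_stabilizer_iff] at hh ⊢
    rw [mul_smul, mul_smul, hh, inv_smul_smul]
  have hv' := hv _ hk
  rw [← smul_mk_eq_fiberAction]
  rw [mul_smul, mul_smul, inv_smul_eq_iff] at hv'
  exact hv'

/-- The fibre of the obstruction bundle at `x`: the quotient of `E x` by its fixed subspace. -/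
abbrev ObstructionFiber (x : B) : Type _ := E x ⧸ fixedSubspace G F E x

variable {G} in
/-- The action on the obstruction fibres induced by the action on `E`. -/
noncomputable def obstructionAction (g : G) (x : B) :
    ObstructionFiber G F E x →ₗ[ℝ] ObstructionFiber G F E (g • x) :=
  (fixedSubspace G F E x).mapQ (fixedSubspace G F E (g • x)) (fiberAction F E g x)
    (fixedSubspace_le_comap G F E g x)

end Algebra

/-- The orbit type stratum `B_(H)`: the points whose isotropy group is conjugate to `H`. -/
def orbitTypeStratum {G : Type*} [Group G] (B : Type*) [MulAction G B] (H : Subgroup G) : Set B :=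
  {x | ∃ g : G, MulAction.stabilizer G x = H.map (MulAut.conj g).toMonoidHom}

/-! ### Submanifolds and smooth subbundles over them -/

/-- `S` is an embedded smooth submanifold of `B`: around each of its points there is a smooth chart
of `B` in which `S` is a linear subspace of the model space. The dimension of that subspace may
vary from one connected component of `S` to another. -/
def IsEmbeddedSubmanifold (EB : Type*) {B : Type*} [NormedAddCommGroup EB] [NormedSpace ℝ EB]
    [TopologicalSpace B] [ChartedSpace EB B] (S : Set B) : Prop :=
  ∀ x ∈ S, ∃ φ ∈ IsManifold.maximalAtlas 𝓘(ℝ, EB) ∞ B, x ∈ φ.source ∧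
    ∃ V : Submodule ℝ EB, ∀ y ∈ φ.source, y ∈ S ↔ φ y ∈ V

section Smooth

variable (G : Type*) (EB : Type*) {B : Type*} (F : Type*) (E : B → Type*)
  [NormedAddCommGroup EB] [NormedSpace ℝ EB] [TopologicalSpace B] [ChartedSpace EB B]
  [NormedAddCommGroup F] [NormedSpace ℝ F]
  [∀ x, AddCommGroup (E x)] [∀ x, Module ℝ (E x)]
  [TopologicalSpace (TotalSpace F E)] [∀ x, TopologicalSpace (E x)] [FiberBundle F E]

/-- The subspaces `W x ≤ E x`, for `x ∈ S`, form a smooth vector subbundle of `E` restricted to `S`: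
near each point of `S` there is a smooth fibrewise linear local trivialization of `E` that carries
`W y`, for all `y` in `S` in its domain, onto one and the same subspace of the model fibre.
(Values of `W` outside `S` are irrelevant.) -/
def IsSmoothSubbundleOn (S : Set B) (W : ∀ x, Submodule ℝ (E x)) : Prop :=
  ∀ x ∈ S, ∃ (e : Trivialization F (π F E)) (W₀ : Submodule ℝ F),
    x ∈ e.baseSet ∧ e.IsLinear ℝ ∧
    ContMDiffOn (𝓘(ℝ, EB).prod 𝓘(ℝ, F)) (𝓘(ℝ, EB).prod 𝓘(ℝ, F)) ∞ e e.source ∧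
    ContMDiffOn (𝓘(ℝ, EB).prod 𝓘(ℝ, F)) (𝓘(ℝ, EB).prod 𝓘(ℝ, F)) ∞
      e.toOpenPartialHomeomorph.symm e.target ∧
    ∀ y ∈ S ∩ e.baseSet, ∀ v : E y, v ∈ W y ↔ (e ⟨y, v⟩).2 ∈ W₀

variable [Group G] [MulAction G B] [MulAction G (TotalSpace F E)] [IsFiberwiseLinearAction G F E]

/-- The subspaces `W x`, for `x` in the invariant set `S`, form a smooth `G`-vector subbundle of `E`
restricted to `S`: they form a smooth vector subbundle, and it is mapped to itself by `G`. -/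
structure IsSmoothGSubbundleOn (S : Set B) (W : ∀ x, Submodule ℝ (E x)) : Prop where
  base_invariant : ∀ (g : G), ∀ x ∈ S, g • x ∈ S
  smooth : IsSmoothSubbundleOn EB F E S W
  invariant : ∀ (g : G), ∀ x ∈ S, ∀ v ∈ W x, fiberAction F E g x v ∈ W (g • x)

/-- The linear maps `σ x : E x / E x ^ f → E x` realize the quotient bundle of `E` restricted to `S`
by the fixed spaces as a complementary smooth `G`-vector subbundle, so that over `S` the bundle `E`
is the direct sum of the `G`-vector bundle of fixed spaces and the obstruction bundle:
`σ` is a splitting of the quotient map, it commutes with the actions of `G`, and its image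
(which is then a complement of the fixed space in each fibre) is a smooth `G`-subbundle. -/
structure IsObstructionSplitting (S : Set B)
    (σ : ∀ x, ObstructionFiber G F E x →ₗ[ℝ] E x) : Prop where
  mkQ_apply : ∀ x ∈ S, ∀ q, (fixedSubspace G F E x).mkQ (σ x q) = q
  equivariant : ∀ (g : G), ∀ x ∈ S, ∀ q,
    fiberAction F E g x (σ x q) = σ (g • x) (obstructionAction F E g x q)
  isCompl : ∀ x ∈ S, IsCompl (fixedSubspace G F E x) (LinearMap.range (σ x))
  subbundle : IsSmoothGSubbundleOn G EB F E S fun x ↦ LinearMap.range (σ x)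

end Smooth

/-! Everything is local near a point `x₀` of the stratum, with compact isotropy group `K`, and rests
on averaging over `K` and on a slice theorem.

Slice. Averaging a chart over `K` makes the action of `K` near `x₀` linear
(`exists_linearizing_chart`). Let `V` be a `K`-invariant complement of the tangent space `R` of the
orbit. Nearby points can be written `y = m y • s y`, with `m y` in a small transversal to `K` in `G`
and `s y` in the slice `V`, and the isotropy group of `s y` lies in `K` (`exists_slice_chart`). A
closed subgroup of a compact group contains no proper conjugate of itself
(`Subgroup.map_conj_eq_of_le`), so `y` is in the stratum exactly when all of `K` fixes `s y`. As `K`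
acts linearly on `V`, this is a linear condition in the chart, and the stratum is a submanifold.

Bundle. Over points fixed by `K` the fibres form a smooth family of representations of `K`.
Averaging intertwiners identifies those near `x₀` with a single representation `ρ` on `F`
(`exists_equivariant_frame`). Moving `y` to `s y` by `(m y)⁻¹` extends this to all nearby points of
the stratum (`exists_adapted_trivialization`), so the fixed spaces all correspond to the fixed space
of `ρ`. Local constancy of their dimension follows.

Complement. The span of the vectors `g v - v`, for `g` in the isotropy group, is complementary to
the fixed vectors of a compact group (`CompactRep.isCompl_fixed_moving`). It is defined without
choices, hence is `G`-invariant, and in the same trivialization it too becomes a constant subspace.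
No invariant metric is needed.

The group `K` enters only as a compact topological group inside `G`. No smooth structure on it is
used: smoothness comes from `G`, and a rank argument replaces the identification of the tangent
space of `K`. -/

set_option linter.unusedSectionVars false

open scoped Topology in
/-- A family of functions that locally factors smoothly through a continuous parameter. -/
def IsSmoothFamilyOn {K X Y : Type*} (C : Type*) [TopologicalSpace K] [NormedAddCommGroup X]
    [NormedSpace ℝ X] [NormedAddCommGroup Y] [NormedSpace ℝ Y] [NormedAddCommGroup C]
    [NormedSpace ℝ C] (f : K → X → Y) (U : Set X) : Prop :=
  ∀ k₀, ∀ x₀ ∈ U, ∃ (c : K → C) (F : C → X → Y), ContinuousAt c k₀ ∧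
    ContDiffAt ℝ ∞ (fun p : C × X ↦ F p.1 p.2) (c k₀, x₀) ∧
    ∀ᶠ p in 𝓝 (k₀, x₀), f p.1 p.2 = F (c p.1) p.2

/-! ### Differentiation under an integral over a compact parameter space -/

section ParametricIntegral

open Topology Filter MeasureTheory Set

variable {K X Y C : Type*} [TopologicalSpace K] [NormedAddCommGroup X]
    [NormedSpace ℝ X] [NormedAddCommGroup Y] [NormedSpace ℝ Y] [NormedAddCommGroup C]
    [NormedSpace ℝ C]

set_option synthInstance.maxHeartbeats 400000 in
theorem ContDiffAt.iteratedFDeriv_snd {F : C → X → Y} {p : C × X}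
    (hF : ContDiffAt ℝ ∞ (fun p : C × X ↦ F p.1 p.2) p) (m : ℕ) :
    ContDiffAt ℝ ∞ (fun p : C × X ↦ iteratedFDeriv ℝ m (F p.1) p.2) p := by
  induction m with
  | zero =>
    simp only [iteratedFDeriv_zero_eq_comp, Function.comp_apply]
    exact ((continuousMultilinearCurryFin0 ℝ X Y).symm.contDiff.contDiffAt).comp p hF
  | succ m ih =>
    simp only [iteratedFDeriv_succ_eq_comp_left, Function.comp_apply]
    have h : ContDiffAt ℝ ∞ (fun p : C × X ↦ fderiv ℝ (iteratedFDeriv ℝ m (F p.1)) p.2) p := by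
      refine ContDiffAt.fderiv (n := ∞) (f := fun (q : C × X) y ↦ iteratedFDeriv ℝ m (F q.1) y)
        (g := Prod.snd) ?_ contDiffAt_snd (by simp)
      exact ContDiffAt.comp (p, p.2) (g := fun p : C × X ↦ iteratedFDeriv ℝ m (F p.1) p.2)
        (f := fun q : (C × X) × X ↦ (q.1.1, q.2)) ih (by fun_prop)
    exact h.continuousLinearMap_comp
      ((continuousMultilinearCurryLeftEquiv ℝ (fun _ : Fin (m + 1) ↦ X) Y).symm :
        _ →L[ℝ] X [×(m + 1)]→L[ℝ] Y)

namespace IsSmoothFamilyOn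

variable {f : K → X → Y} {U : Set X}

theorem eventually_eventuallyEq {c : K → C} {F : C → X → Y} {k₀ : K} {x₀ : X}
    (h : ∀ᶠ p in 𝓝 (k₀, x₀), f p.1 p.2 = F (c p.1) p.2) :
    ∀ᶠ p in 𝓝 (k₀, x₀), f p.1 =ᶠ[𝓝 p.2] F (c p.1) := by
  filter_upwards [h.eventually_nhds] with p hp
  exact (Continuous.prodMk_right p.1).continuousAt.eventually hp

theorem continuousAt_iteratedFDeriv (hf : IsSmoothFamilyOn C f U) (m : ℕ) (k : K) {x : X}
    (hx : x ∈ U) : ContinuousAt (fun p : K × X ↦ iteratedFDeriv ℝ m (f p.1) p.2) (k, x) := by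
  obtain ⟨c, F, hc, hF, h⟩ := hf k x hx
  have h1 := (hF.iteratedFDeriv_snd m).continuousAt
  have h2 : ContinuousAt (fun p : K × X ↦ (c p.1, p.2)) (k, x) :=
    (hc.comp continuousAt_fst).prodMk continuousAt_snd
  refine (ContinuousAt.comp (f := fun p : K × X ↦ (c p.1, p.2)) (x := (k, x)) h1 h2).congr ?_
  filter_upwards [eventually_eventuallyEq h] with p hp
  exact (hp.iteratedFDeriv ℝ m).eq_of_nhds.symm

theorem contDiffAt (hf : IsSmoothFamilyOn C f U) (k : K) {x : X} (hx : x ∈ U) :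
    ContDiffAt ℝ ∞ (f k) x := by
  obtain ⟨c, F, hc, hF, h⟩ := hf k x hx
  refine ContDiffAt.congr_of_eventuallyEq ?_ (eventually_eventuallyEq h).self_of_nhds
  exact ContDiffAt.comp x (g := fun p : C × X ↦ F p.1 p.2) (f := fun x ↦ (c k, x)) hF (by fun_prop)

theorem continuousAt_fderiv (hf : IsSmoothFamilyOn C f U) (k : K) {x : X} (hx : x ∈ U) :
    ContinuousAt (fun p : K × X ↦ fderiv ℝ (f p.1) p.2) (k, x) := by
  obtain ⟨c, F, hc, hF, h⟩ := hf k x hx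
  have h1 : ContDiffAt ℝ 0 (fun p : C × X ↦ fderiv ℝ (F p.1) p.2) (c k, x) := by
    refine ContDiffAt.fderiv (n := ∞) (f := fun (q : C × X) y ↦ F q.1 y)
      (g := Prod.snd) ?_ contDiffAt_snd (by simp)
    exact ContDiffAt.comp ((c k, x), x) (g := fun p : C × X ↦ F p.1 p.2)
      (f := fun q : (C × X) × X ↦ (q.1.1, q.2)) hF (by fun_prop)
  have h2 : ContinuousAt (fun p : K × X ↦ (c p.1, p.2)) (k, x) :=
    (hc.comp continuousAt_fst).prodMk continuousAt_snd
  refine (ContinuousAt.comp (f := fun p : K × X ↦ (c p.1, p.2)) (x := (k, x))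
    h1.continuousAt h2).congr ?_
  filter_upwards [eventually_eventuallyEq h] with p hp
  exact hp.fderiv.eq_of_nhds.symm

variable [CompactSpace K] [MeasurableSpace K] [BorelSpace K]

/-- Compactness of `K` turns joint continuity of the derivatives into a bound uniform in `k` and
locally uniform in `x`. It serves as the dominating function below. -/
theorem exists_norm_iteratedFDeriv_le (hf : IsSmoothFamilyOn C f U) (m : ℕ) {x : X}
    (hx : x ∈ U) : ∃ M : ℝ, ∀ᶠ y in 𝓝 x, ∀ k, ‖iteratedFDeriv ℝ m (f k) y‖ ≤ M := by
  have hc : Continuous fun k ↦ ‖iteratedFDeriv ℝ m (f k) x‖ := by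
    refine continuous_norm.comp (continuous_iff_continuousAt.2 fun k ↦ ?_)
    exact ContinuousAt.comp (f := fun k ↦ (k, x)) (x := k)
      (hf.continuousAt_iteratedFDeriv m k hx) (by fun_prop)
  obtain ⟨M, hM⟩ := (isCompact_range hc).bddAbove
  refine ⟨M + 1, ?_⟩
  have := (isCompact_univ (X := K)).eventually_forall_of_forall_eventually (x₀ := x)
    (P := fun y k ↦ ‖iteratedFDeriv ℝ m (f k) y‖ ≤ M + 1) fun k _ ↦ by
      have h1 : ContinuousAt (fun p : X × K ↦ ‖iteratedFDeriv ℝ m (f p.2) p.1‖) (x, k) :=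
        (ContinuousAt.comp (f := Prod.swap) (x := (x, k))
          (hf.continuousAt_iteratedFDeriv m k hx) (by fun_prop)).norm
      have h2 : ‖iteratedFDeriv ℝ m (f k) x‖ < M + 1 :=
        (hM (mem_range_self k)).trans_lt (lt_add_one M)
      exact (h1.eventually (gt_mem_nhds h2)).mono fun _ h ↦ h.le
  simpa using this

theorem continuous_iteratedFDeriv (hf : IsSmoothFamilyOn C f U) (m : ℕ) {x : X} (hx : x ∈ U) :
    Continuous fun k ↦ iteratedFDeriv ℝ m (f k) x :=
  continuous_iff_continuousAt.2 fun k ↦ ContinuousAt.comp (f := fun k ↦ (k, x)) (x := k)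
      (hf.continuousAt_iteratedFDeriv m k hx) (by fun_prop)

theorem continuous_left (hf : IsSmoothFamilyOn C f U) {x : X} (hx : x ∈ U) :
    Continuous fun k ↦ f k x := by
  have := (continuousMultilinearCurryFin0 ℝ X Y).continuous.comp
    (hf.continuous_iteratedFDeriv 0 hx)
  simpa [iteratedFDeriv_zero_eq_comp, Function.comp_def] using this

set_option synthInstance.maxHeartbeats 400000 in
-- The integrated derivatives are a Taylor series because each order follows from the previous one
-- by dominated differentiation with a constant bound, integrable for a finite measure; currying
-- commutes with the integral.
theorem hasFTaylorSeriesUpToOn_integral [CompleteSpace Y] (hf : IsSmoothFamilyOn C f U)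
    (hU : IsOpen U) (μ : Measure K) [IsFiniteMeasure μ] :
    HasFTaylorSeriesUpToOn ∞ (fun x ↦ ∫ k, f k x ∂μ)
      (fun x m ↦ ∫ k, iteratedFDeriv ℝ m (f k) x ∂μ) U := by
  have hint (m : ℕ) {x : X} (hx : x ∈ U) : Integrable (fun k ↦ iteratedFDeriv ℝ m (f k) x) μ :=
    (hf.continuous_iteratedFDeriv m hx).integrable_of_hasCompactSupport
      (HasCompactSupport.of_compactSpace _)
  have hd (m : ℕ) {x : X} (hx : x ∈ U) :
      HasFDerivAt (fun x ↦ ∫ k, iteratedFDeriv ℝ m (f k) x ∂μ)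
        (∫ k, iteratedFDeriv ℝ (m + 1) (f k) x ∂μ).curryLeft x := by
    obtain ⟨M, hM⟩ := hf.exists_norm_iteratedFDeriv_le (m + 1) hx
    have h1 := hasFDerivAt_integral_of_dominated_of_fderiv_le (𝕜 := ℝ) (μ := μ) (x₀ := x)
      (s := {y | y ∈ U ∧ ∀ k, ‖iteratedFDeriv ℝ (m + 1) (f k) y‖ ≤ M}) (bound := fun _ ↦ M)
      (F := fun x k ↦ iteratedFDeriv ℝ m (f k) x)
      (F' := fun x k ↦ (iteratedFDeriv ℝ (m + 1) (f k) x).curryLeft)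
      ((hU.eventually_mem hx).and hM)
      (by filter_upwards [hU.mem_nhds hx] with y hy using (hint m hy).aestronglyMeasurable)
      (hint m hx)
      (((continuousMultilinearCurryLeftEquiv ℝ (fun _ : Fin (m + 1) ↦ X) Y).continuous.comp_aestronglyMeasurable
        (hint (m + 1) hx).aestronglyMeasurable))
      (by
        refine Eventually.of_forall fun k y hy ↦ ?_
        rw [ContinuousMultilinearMap.curryLeft_norm]
        exact hy.2 k)
      (integrable_const M)
      (by
        refine Eventually.of_forall fun k y hy ↦ ?_
        have := (hf.contDiffAt k hy.1).differentiableAt_iteratedFDeriv (m := m)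
          (by exact_mod_cast WithTop.coe_lt_coe.2 (ENat.natCast_lt_top m))
        have h2 := this.hasFDerivAt
        rw [fderiv_iteratedFDeriv] at h2
        exact h2)
    refine h1.congr_fderiv ?_
    exact (ContinuousLinearMap.integral_comp_comm (Fₗ := X →L[ℝ] X [×m]→L[ℝ] Y) (𝕜 := ℝ)
      (continuousMultilinearCurryLeftEquiv ℝ (fun _ : Fin (m + 1) ↦ X) Y :
        (X [×(m + 1)]→L[ℝ] Y) →L[ℝ] X →L[ℝ] X [×m]→L[ℝ] Y) (hint (m + 1) hx))
  refine ⟨fun x hx ↦ ?_, fun m _ x hx ↦ (hd m hx).hasFDerivWithinAt,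
    fun m _ x hx ↦ (hd m hx).continuousAt.continuousWithinAt⟩
  have := ((continuousMultilinearCurryFin0 ℝ X Y).toContinuousLinearEquiv.integral_comp_comm
    (fun k ↦ iteratedFDeriv ℝ 0 (f k) x) (μ := μ)).symm
  exact this

theorem contDiffOn_integral [CompleteSpace Y] (hf : IsSmoothFamilyOn C f U)
    (hU : IsOpen U) (μ : Measure K) [IsFiniteMeasure μ] :
    ContDiffOn ℝ ∞ (fun x ↦ ∫ k, f k x ∂μ) U :=
  (hf.hasFTaylorSeriesUpToOn_integral hU μ).contDiffOn

theorem hasFDerivAt_integral [CompleteSpace Y] (hf : IsSmoothFamilyOn C f U)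
    (hU : IsOpen U) (μ : Measure K) [IsFiniteMeasure μ] {x : X} (hx : x ∈ U) :
    HasFDerivAt (fun x ↦ ∫ k, f k x ∂μ) (∫ k, fderiv ℝ (f k) x ∂μ) x := by
  have h := (hf.hasFTaylorSeriesUpToOn_integral hU μ).hasFDerivAt (by simp) (hU.mem_nhds hx)
  convert h using 1
  have := ((continuousMultilinearCurryFin1 ℝ X Y).toContinuousLinearEquiv.integral_comp_comm
    (fun k ↦ iteratedFDeriv ℝ 1 (f k) x) (μ := μ))
  refine Eq.trans ?_ this
  congr 1
  ext k v
  simp [iteratedFDeriv_one_apply]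

end IsSmoothFamilyOn

end ParametricIntegral

/-! ### Inverse function theorem and a rank argument -/

section InverseFunction

open Topology Filter Set

variable {X Y : Type*} [NormedAddCommGroup X] [NormedSpace ℝ X] [NormedAddCommGroup Y]
  [NormedSpace ℝ Y]

/-- Invertibility of the derivative is an open condition. Shrinking the source to the points of `U`
where it holds makes the inverse smooth on the whole target, not only at the image of `x₀`. -/
theorem exists_openPartialHomeomorph_of_contDiffOn [CompleteSpace X] {f : X → Y} {U : Set X}
    (hU : IsOpen U) (hf : ContDiffOn ℝ ∞ f U) {x₀ : X} (hx₀ : x₀ ∈ U) (f' : X ≃L[ℝ] Y)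
    (hf' : HasFDerivAt f (f' : X →L[ℝ] Y) x₀) :
    ∃ h : OpenPartialHomeomorph X Y, x₀ ∈ h.source ∧ h.source ⊆ U ∧ ⇑h = f ∧
      ContDiffOn ℝ ∞ h.symm h.target ∧
      ∀ x ∈ h.source, ∃ e : X ≃L[ℝ] Y, HasFDerivAt f (e : X →L[ℝ] Y) x := by
  have hfa : ContDiffAt ℝ ∞ f x₀ := hf.contDiffAt (hU.mem_nhds hx₀)
  have hopen : IsOpen (U ∩ fderiv ℝ f ⁻¹' range ((↑) : (X ≃L[ℝ] Y) → X →L[ℝ] Y)) :=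
    (hf.continuousOn_fderiv_of_isOpen hU (by simp)).isOpen_inter_preimage hU
      ContinuousLinearEquiv.isOpen
  let h₀ := hfa.toOpenPartialHomeomorph f hf' (by simp)
  have hd : ∀ x ∈ (h₀.restrOpen _ hopen).source,
      ∃ e : X ≃L[ℝ] Y, HasFDerivAt f (e : X →L[ℝ] Y) x := by
    rintro x ⟨-, hxU, e, he⟩
    refine ⟨e, ?_⟩
    rw [he]
    exact ((hf.contDiffAt (hU.mem_nhds hxU)).differentiableAt (by simp)).hasFDerivAt
  refine ⟨h₀.restrOpen _ hopen, ⟨hfa.mem_toOpenPartialHomeomorph_source hf' _, hx₀, f', ?_⟩,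
    fun x hx ↦ hx.2.1, rfl, fun y hy ↦ ?_, hd⟩
  · exact hf'.fderiv.symm
  · have hx := (h₀.restrOpen _ hopen).map_target hy
    obtain ⟨e, he⟩ := hd _ hx
    exact ((h₀.restrOpen _ hopen).contDiffAt_symm hy he
      (hf.contDiffAt (hU.mem_nhds hx.2.1))).contDiffWithinAt

/-- A local retraction-like map onto a graph: if `w` restricts to the inclusion `a ↦ (a, 0)` on the
subspace `M`, and its rank is at most the dimension of `M`, then it takes values in `M × 0`. -/
theorem eventually_snd_eq_zero_of_finrank_range_le [FiniteDimensional ℝ X] {M : Submodule ℝ X}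
    {w : X → M × Y} {U : Set X} (hU : IsOpen U) (h0 : (0 : X) ∈ U) (hw : ContDiffOn ℝ ∞ w U)
    (hM : ∀ᶠ a : M in 𝓝 0, w a = (a, 0))
    (hrank : ∀ x ∈ U, finrank ℝ (LinearMap.range (fderiv ℝ w x).toLinearMap) ≤ finrank ℝ M) :
    ∀ᶠ x in 𝓝 0, (w x).2 = 0 := by
  obtain ⟨N, hMN⟩ := Submodule.exists_isCompl M
  let κ : X →L[ℝ] N := LinearMap.toContinuousLinearMap (N.projectionOnto M hMN.symm)
  have hκM (a : M) : κ a = 0 := Submodule.projectionOnto_apply_right hMN.symm a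
  have hw' {x : X} (hx : x ∈ U) : HasFDerivAt w (fderiv ℝ w x) x :=
    ((hw.contDiffAt (hU.mem_nhds hx)).differentiableAt (by simp)).hasFDerivAt
  -- `θ` keeps the first component of `w` and replaces the second by a coordinate transverse to `M`.
  -- It is a local diffeomorphism at `0`, since `w` is the inclusion along `M` and `κ` has kernel
  -- `M`.
  let θ : X → M × N := fun x ↦ ((w x).1, κ x)
  have hθ : ContDiffOn ℝ ∞ θ U := hw.fst.prodMk κ.contDiff.contDiffOn
  have hθ' {x : X} (hx : x ∈ U) :
      HasFDerivAt θ (((ContinuousLinearMap.fst ℝ M Y).comp (fderiv ℝ w x)).prod κ) x :=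
    (hw' hx).fst.prodMk κ.hasFDerivAt
  have hw0 : w 0 = 0 := by simpa [Prod.ext_iff] using hM.self_of_nhds
  have hDM (a : M) : fderiv ℝ w 0 a = (a, 0) := by
    have h1 : HasFDerivAt (fun a : M ↦ w a) ((fderiv ℝ w 0).comp M.subtypeL) 0 :=
      HasFDerivAt.comp (f := M.subtypeL) (0 : M) (by simpa using hw' h0) M.subtypeL.hasFDerivAt
    have h2 : HasFDerivAt (fun a : M ↦ w a) (ContinuousLinearMap.inl ℝ M Y) 0 :=
      (ContinuousLinearMap.inl ℝ M Y).hasFDerivAt.congr_of_eventuallyEq hM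
    exact DFunLike.congr_fun (h1.unique h2) a
  let T := ((ContinuousLinearMap.fst ℝ M Y).comp (fderiv ℝ w 0)).prod κ
  have hT : Function.Injective T.toLinearMap := by
    rw [← LinearMap.ker_eq_bot, LinearMap.ker_eq_bot']
    intro x hx
    have hx' : (fderiv ℝ w 0 x).1 = 0 ∧ κ x = 0 := by simpa [T] using hx
    have hxM : x ∈ M := (Submodule.projectionOnto_apply_eq_zero_iff hMN.symm).1 hx'.2
    have := hDM ⟨x, hxM⟩
    simp only at this
    rw [this] at hx'
    simpa using hx'.1
  have hdim : finrank ℝ X = finrank ℝ (M × N) := by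
    rw [Module.finrank_prod, Submodule.finrank_add_eq_of_isCompl hMN]
  let Te : X ≃L[ℝ] M × N :=
    (LinearEquiv.ofInjectiveOfFinrankEq T.toLinearMap hT hdim).toContinuousLinearEquiv
  have hTe : (Te : X →L[ℝ] M × N) = T := by ext x <;> rfl
  obtain ⟨h, h0s, hsU, hθh, hsymm, hinv⟩ :=
    exists_openPartialHomeomorph_of_contDiffOn hU hθ h0 Te (hTe ▸ hθ' h0)
  have hθ0 : θ 0 = 0 := by simp [θ, hw0]
  have h0t : (0 : M × N) ∈ h.target := by
    have := h.map_source h0s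
    rwa [hθh, hθ0] at this
  have hsrc : ∀ᶠ a : M in 𝓝 0, (a : X) ∈ h.source :=
    M.subtypeL.continuous.continuousAt.eventually
      (h.open_source.eventually_mem (by simpa using h0s))
  obtain ⟨r, hr, hball⟩ := Metric.eventually_nhds_iff_ball.1 (hM.and hsrc)
  obtain ⟨r', hr', hball'⟩ := Metric.isOpen_iff.1 h.open_target 0 h0t
  let ρ := min r r'
  have hρ : 0 < ρ := lt_min hr hr'
  have hθc : ContinuousAt θ 0 := (hθ' h0).continuousAt
  have hev : ∀ᶠ x in 𝓝 0, θ x ∈ Metric.ball (0 : M × N) ρ :=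
    hθc.eventually (by rw [hθ0]; exact Metric.ball_mem_nhds _ hρ)
  filter_upwards [hev, h.open_source.eventually_mem h0s] with x hx hxs
  -- With the first coordinate held fixed, the derivative of `w` in the direction of `N` has zero
  -- first component. The rank bound makes the first projection injective on the range of that
  -- derivative, so the second component vanishes too.
  have hkey : ∀ b ∈ Metric.ball (0 : N) ρ, ((θ x).1, b) ∈ h.target ∧
      HasFDerivAt (fun b ↦ (w (h.symm ((θ x).1, b))).2) (0 : N →L[ℝ] Y) b := by
    intro b hb
    have ht : ((θ x).1, b) ∈ h.target := by
      refine hball' (Metric.ball_subset_ball (min_le_right r r') ?_)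
      simp only [Metric.mem_ball, dist_zero_right] at hx hb ⊢
      exact max_lt ((norm_fst_le (θ x)).trans_lt hx) hb
    refine ⟨ht, ?_⟩
    let y := h.symm ((θ x).1, b)
    have hy : y ∈ h.source := h.map_target ht
    have hyU := hsU hy
    have hη : HasFDerivAt h.symm (fderiv ℝ h.symm ((θ x).1, b)) ((θ x).1, b) :=
      ((hsymm.contDiffAt (h.open_target.mem_nhds ht)).differentiableAt (by simp)).hasFDerivAt
    let ξ : N →L[ℝ] X := (fderiv ℝ h.symm ((θ x).1, b)).comp (ContinuousLinearMap.inr ℝ M N)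
    have hc : HasFDerivAt (fun b ↦ h.symm ((θ x).1, b)) ξ b :=
      hη.comp b (hasFDerivAt_prodMk_right _ _)
    have hwc : HasFDerivAt (fun b ↦ w (h.symm ((θ x).1, b))) ((fderiv ℝ w y).comp ξ) b :=
      (hw' hyU).comp b hc
    have hfst : ∀ v, (fderiv ℝ w y (ξ v)).1 = 0 := by
      have h1 : HasFDerivAt (fun b ↦ (w (h.symm ((θ x).1, b))).1) (0 : N →L[ℝ] M) b := by
        refine (hasFDerivAt_const (θ x).1 b).congr_of_eventuallyEq ?_
        have : ∀ᶠ b' in 𝓝 b, ((θ x).1, b') ∈ h.target :=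
          (Continuous.prodMk_right (θ x).1).continuousAt.eventually
            (h.open_target.eventually_mem ht)
        filter_upwards [this] with b' hb'
        have := h.right_inv hb'
        rw [hθh] at this
        exact (congrArg (fun p : M × N ↦ p.1) this :)
      intro v
      exact DFunLike.congr_fun (hwc.fst.unique h1) v
    obtain ⟨e, he⟩ := hinv y hy
    have hsurj : LinearMap.range ((LinearMap.fst ℝ M Y) ∘ₗ (fderiv ℝ w y).toLinearMap) = ⊤ := by
      rw [LinearMap.range_eq_top]
      intro a
      obtain ⟨z, hz⟩ := e.surjective (a, 0)
      have h3 := DFunLike.congr_fun (he.unique (hθ' hyU)) z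
      refine ⟨z, ?_⟩
      have := congrArg Prod.fst (hz.symm.trans h3)
      simpa using this.symm
    have hinj : Function.Injective ((LinearMap.fst ℝ M Y).domRestrict
        (LinearMap.range (fderiv ℝ w y).toLinearMap)) := by
      rw [← LinearMap.ker_eq_bot]
      have h4 := LinearMap.finrank_range_add_finrank_ker ((LinearMap.fst ℝ M Y).domRestrict
        (LinearMap.range (fderiv ℝ w y).toLinearMap))
      have h5 : LinearMap.range ((LinearMap.fst ℝ M Y).domRestrict
          (LinearMap.range (fderiv ℝ w y).toLinearMap)) = ⊤ := by
        rw [LinearMap.domRestrict, LinearMap.range_comp, Submodule.range_subtype,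
          ← LinearMap.range_comp, hsurj]
      rw [h5, finrank_top] at h4
      have := hrank y hyU
      exact Submodule.finrank_eq_zero.1 (by omega)
    refine (hwc.snd).congr_fderiv ?_
    ext v
    have h6 : (⟨fderiv ℝ w y (ξ v), ⟨ξ v, rfl⟩⟩ :
        LinearMap.range (fderiv ℝ w y).toLinearMap) = 0 := hinj (by
      simpa using hfst v)
    have h7 : fderiv ℝ w y (ξ v) = 0 := congrArg Subtype.val h6
    simp [h7]
  have hx2 : (θ x).2 ∈ Metric.ball (0 : N) ρ := by
    simp only [Metric.mem_ball, dist_zero_right] at hx ⊢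
    exact (norm_snd_le _).trans_lt hx
  -- Constancy on the ball compares `x` with the point of `M` having the same first coordinate,
  -- where `hM` gives second component `0`.
  have hconst := Metric.isOpen_ball.is_const_of_fderiv_eq_zero (𝕜 := ℝ)
    (convex_ball (0 : N) ρ).isPreconnected
    (fun b hb ↦ (hkey b hb).2.differentiableAt.differentiableWithinAt)
    (fun b hb ↦ (hkey b hb).2.fderiv) hx2 (Metric.mem_ball_self hρ)
  have e1 : h.symm ((θ x).1, (θ x).2) = x := by
    have := h.left_inv hxs
    rwa [hθh] at this
  have hx1 : (θ x).1 ∈ Metric.ball (0 : M) r := by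
    simp only [Metric.mem_ball, dist_zero_right] at hx ⊢
    exact ((norm_fst_le _).trans_lt hx).trans_le (min_le_left _ _)
  obtain ⟨hwa, has⟩ := hball _ hx1
  have e2 : h.symm ((θ x).1, 0) = ((θ x).1 : X) := by
    have := h.left_inv has
    rw [hθh] at this
    have h8 : θ ((θ x).1 : X) = ((θ x).1, 0) := by
      simp only [θ] at hwa ⊢
      rw [hwa, hκM]
    rwa [h8] at this
  rw [e1, e2, hwa] at hconst
  exact hconst

end InverseFunction

/-! ### Haar averaging and representations of compact groups -/

section CompactGroup

open Topology Filter MeasureTheory Set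

/-- A right translate of normalized Haar measure is again a left-invariant Haar probability measure,
so uniqueness gives right invariance. -/
theorem exists_isProbabilityMeasure_isMulRightInvariant (K : Type*) [Group K] [TopologicalSpace K]
    [IsTopologicalGroup K] [CompactSpace K] [MeasurableSpace K] [BorelSpace K] :
    ∃ μ : Measure K, IsProbabilityMeasure μ ∧ μ.IsMulLeftInvariant ∧ μ.IsMulRightInvariant := by
  let μ := Measure.haarMeasure (⊤ : TopologicalSpace.PositiveCompacts K)
  have hμ : IsProbabilityMeasure μ :=
    ⟨by simpa using Measure.haarMeasure_self (K₀ := (⊤ : TopologicalSpace.PositiveCompacts K))⟩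
  refine ⟨μ, hμ, inferInstance, ⟨fun g ↦ ?_⟩⟩
  have hp : IsProbabilityMeasure (μ.map (· * g)) :=
    Measure.isProbabilityMeasure_map (measurable_mul_const g).aemeasurable
  have hH : (μ.map (· * g)).IsHaarMeasure :=
    { toIsMulLeftInvariant := isMulLeftInvariant_map_mul_right g
      lt_top_of_isCompact := fun _ _ ↦ measure_lt_top _ _
      toIsOpenPosMeasure :=
        (continuous_mul_const g).isOpenPosMeasure_map (Group.mulRight_bijective g).surjective }
  exact Measure.isHaarMeasure_eq_of_isProbabilityMeasure _ _

/-- A closed subgroup of a compact group is not conjugate to a proper subgroup of itself. -/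
theorem Subgroup.map_conj_eq_of_le {G : Type*} [Group G] [TopologicalSpace G]
    [IsTopologicalGroup G] [CompactSpace G] {K : Subgroup G} (hK : IsClosed (K : Set G)) (g : G)
    (h : K.map (MulAut.conj g).toMonoidHom ≤ K) : K.map (MulAut.conj g).toMonoidHom = K := by
  refine le_antisymm h fun k hk ↦ ?_
  -- `S` is closed and contains all powers `g ^ n`. In a compact group the closure of these powers
  -- contains `g⁻¹`, so `g⁻¹` also conjugates `K` into itself.
  let S : Set G := ⋂ k ∈ K, {a | a * k * a⁻¹ ∈ K}
  have hS : IsClosed S := isClosed_biInter fun k _ ↦ hK.preimage (by fun_prop)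
  have hpow (n : ℕ) : g ^ n ∈ S := by
    simp only [S, mem_iInter, mem_ofPred_eq]
    induction n with
    | zero => intro k hk; simpa using hk
    | succ n ih =>
      intro k hk
      have := ih _ (h ⟨k, hk, rfl⟩)
      simpa [pow_succ, mul_assoc] using this
  have hcl : g⁻¹ ∈ _root_.closure (range (g ^ · : ℕ → G)) :=
    ((mapClusterPt_atTop_pow_tfae g⁻¹ g).out 2 3).2 (_root_.subset_closure (mem_range.2 ⟨-1, by simp⟩))
  have hg : g⁻¹ ∈ S := closure_minimal (range_subset_iff.2 hpow) hS hcl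
  simp only [S, mem_iInter, mem_ofPred_eq] at hg
  exact ⟨g⁻¹ * k * g, by simpa using hg k hk, by simp [mul_assoc]⟩

namespace CompactRep

variable {K F : Type*} [Group K] [TopologicalSpace K] [IsTopologicalGroup K] [CompactSpace K]
  [NormedAddCommGroup F] [NormedSpace ℝ F] [FiniteDimensional ℝ F]
  {ρ : K →* (F →L[ℝ] F)}

/-- Averaging the conjugates of any projection onto `R` gives an equivariant projection onto `R`;
its kernel is the complement. -/
theorem exists_invariant_isCompl (hρ : Continuous ρ) (R : Submodule ℝ F)
    (hR : ∀ k, ∀ v ∈ R, ρ k v ∈ R) :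
    ∃ V : Submodule ℝ F, IsCompl R V ∧ ∀ k, ∀ v ∈ V, ρ k v ∈ V := by
  borelize K
  obtain ⟨μ, hμ, -, hμr⟩ := exists_isProbabilityMeasure_isMulRightInvariant K
  obtain ⟨R', hR'⟩ := Submodule.exists_isCompl R
  let p : F →L[ℝ] F := LinearMap.toContinuousLinearMap (R.subtype ∘ₗ R.projectionOnto R' hR')
  have hpR (v : F) : p v ∈ R := (R.projectionOnto R' hR' v).2
  have hpid {v : F} (hv : v ∈ R) : p v = v := by
    have := Submodule.projectionOnto_apply_left hR' ⟨v, hv⟩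
    exact congrArg Subtype.val this
  have hcont : Continuous fun l : K ↦ (ρ l⁻¹).comp (p.comp (ρ l)) :=
    (hρ.comp continuous_inv).clm_comp (continuous_const.clm_comp hρ)
  have hint : Integrable (fun l : K ↦ (ρ l⁻¹).comp (p.comp (ρ l))) μ :=
    hcont.integrable_of_hasCompactSupport (HasCompactSupport.of_compactSpace _)
  let P : F →L[ℝ] F := ∫ l : K, (ρ l⁻¹).comp (p.comp (ρ l)) ∂μ
  have hP (v : F) : P v = ∫ l : K, ρ l⁻¹ (p (ρ l v)) ∂μ :=
    ContinuousLinearMap.integral_apply hint v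
  have hPR (v : F) : P v ∈ R := by
    rw [hP]
    exact R.toConvexCone.convex.integral_mem (Submodule.closed_of_finiteDimensional R)
      (Eventually.of_forall fun l ↦ hR _ _ (hpR _)) (hint.apply_continuousLinearMap v)
  have hPid {v : F} (hv : v ∈ R) : P v = v := by
    rw [hP]
    have : ∀ l : K, ρ l⁻¹ (p (ρ l v)) = v := fun l ↦ by
      rw [hpid (hR l v hv), ← mul_apply_eq_comp, ← map_mul, inv_mul_cancel, map_one,
        one_apply_eq_self]
    simp [this]
  have hPρ (k : K) (v : F) : P (ρ k v) = ρ k (P v) := by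
    have h1 : ρ k (∫ l : K, ρ l⁻¹ (p (ρ l v)) ∂μ) = ∫ l : K, ρ k (ρ l⁻¹ (p (ρ l v))) ∂μ :=
      (ContinuousLinearMap.integral_comp_comm _ (hint.apply_continuousLinearMap v)).symm
    rw [hP, hP, h1, ← integral_mul_right_eq_self (μ := μ) (fun l ↦ ρ k (ρ l⁻¹ (p (ρ l v)))) k]
    congr 1 with l
    rw [map_mul ρ l k, mul_apply_eq_comp, ← mul_apply_eq_comp (ρ k), ← map_mul, mul_inv_rev,
      mul_inv_cancel_left]
  refine ⟨LinearMap.ker P.toLinearMap, ?_, fun k v hv ↦ ?_⟩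
  · refine IsCompl.of_eq ?_ ?_
    · rw [Submodule.eq_bot_iff]
      rintro v ⟨hv, hv'⟩
      rw [← hPid hv]
      exact hv'
    · rw [Submodule.eq_top_iff']
      intro v
      refine Submodule.mem_sup.2 ⟨P v, hPR v, v - P v, ?_, by simp⟩
      simp [hPid (hPR v)]
  · have hv' : P v = 0 := hv
    simp [hPρ, hv']

variable (ρ) in
/-- The subspace of fixed vectors. -/
def fixed : Submodule ℝ F where
  carrier := {v | ∀ k, ρ k v = v}
  zero_mem' := by simp
  add_mem' := by
    intro v w hv hw k
    rw [map_add, hv k, hw k]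
  smul_mem' := by
    intro c v hv k
    rw [map_smul, hv k]

variable (ρ) in
/-- The span of the vectors `ρ k v - v`. -/
def moving : Submodule ℝ F := Submodule.span ℝ {w | ∃ k v, ρ k v - v = w}

/-- The average `P` of `ρ` is a projection onto the fixed vectors. It kills each `ρ k v - v` by
right invariance, while `P v - v` is an average of vectors `ρ l v - v` and so stays in the closed
subspace `moving ρ`. -/
theorem isCompl_fixed_moving (hρ : Continuous ρ) : IsCompl (fixed ρ) (moving ρ) := by
  borelize K
  obtain ⟨μ, hμ, hμl, hμr⟩ := exists_isProbabilityMeasure_isMulRightInvariant K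
  have hint : Integrable ρ μ :=
    hρ.integrable_of_hasCompactSupport (HasCompactSupport.of_compactSpace _)
  let P : F →L[ℝ] F := ∫ l : K, ρ l ∂μ
  have hP (v : F) : P v = ∫ l : K, ρ l v ∂μ :=
    ContinuousLinearMap.integral_apply hint v
  have hPfix (v : F) : P v ∈ fixed ρ := by
    intro k
    rw [hP, ← ContinuousLinearMap.integral_comp_comm _ (hint.apply_continuousLinearMap v),
      ← integral_mul_left_eq_self (μ := μ) (fun l ↦ ρ l v) k]
    simp
  have hPid {v : F} (hv : v ∈ fixed ρ) : P v = v := by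
    rw [hP]
    simp [hv _]
  have hPmov {v : F} (hv : v ∈ moving ρ) : P v = 0 := by
    have : moving ρ ≤ LinearMap.ker P.toLinearMap := by
      refine Submodule.span_le.2 ?_
      rintro _ ⟨k, v, rfl⟩
      simp only [SetLike.mem_coe, LinearMap.mem_ker, ContinuousLinearMap.coe_coe, map_sub,
        sub_eq_zero]
      rw [hP, hP, ← integral_mul_right_eq_self (μ := μ) (fun l ↦ ρ l v) k]
      simp
    exact this hv
  refine IsCompl.of_eq ?_ ?_
  · rw [Submodule.eq_bot_iff]
    rintro v ⟨hv, hv'⟩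
    rw [← hPid hv, hPmov hv']
  · rw [Submodule.eq_top_iff']
    intro v
    refine Submodule.mem_sup.2 ⟨P v, hPfix v, v - P v, ?_, by simp⟩
    have h1 : P v - v = ∫ l : K, (ρ l v - v) ∂μ := by
      rw [integral_sub (hint.apply_continuousLinearMap v) (integrable_const v), hP]
      simp
    rw [← neg_sub, neg_mem_iff, h1]
    exact (moving ρ).toConvexCone.convex.integral_mem (Submodule.closed_of_finiteDimensional _)
      (Eventually.of_forall fun l ↦ Submodule.subset_span ⟨l, v, rfl⟩)
      ((hint.apply_continuousLinearMap v).sub (integrable_const v))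

end CompactRep

end CompactGroup

/-! ### Linearizing the action of an isotropy group -/

section Linearization

open Topology Filter MeasureTheory Set

theorem isOpen_setOf_forall_smul_mem {K B : Type*} [Group K] [TopologicalSpace K] [CompactSpace K]
    [TopologicalSpace B] [MulAction K B] [ContinuousSMul K B] {W : Set B} (hW : IsOpen W) :
    IsOpen {y : B | ∀ k : K, k • y ∈ W} := by
  refine isOpen_iff_eventually.2 fun y hy ↦ ?_
  have := (isCompact_univ (X := K)).eventually_forall_of_forall_eventually (x₀ := y)
    (P := fun y k ↦ k • y ∈ W) fun k _ ↦
      (continuous_snd.smul continuous_fst).continuousAt.eventually (hW.eventually_mem (hy k))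
  simpa using this

variable {EG : Type*} [NormedAddCommGroup EG] [NormedSpace ℝ EG]
    {G : Type*} [TopologicalSpace G] [ChartedSpace EG G] [Group G] [LieGroup 𝓘(ℝ, EG) ∞ G]
    {EB : Type*} [NormedAddCommGroup EB] [NormedSpace ℝ EB]
    {B : Type*} [TopologicalSpace B] [ChartedSpace EB B] [IsManifold 𝓘(ℝ, EB) ∞ B]
    {Y : Type*} [NormedAddCommGroup Y] [NormedSpace ℝ Y]

variable (EG) in
-- The pair of the coordinate of `k` in a chart of `G` and the operator `L k` is a parameter that
-- depends only continuously on `k`, yet the family is smooth in it. This is what allows `K` to have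
-- no smooth structure.
theorem isSmoothFamilyOn_of_contMDiffAt {K : Subgroup G} {φ : OpenPartialHomeomorph B EB}
    (hφ : φ ∈ IsManifold.maximalAtlas 𝓘(ℝ, EB) ∞ B) {U : Set EB} (hU : U ⊆ φ.target)
    {f : G → B → Y} (hf : ∀ k ∈ K, ∀ x ∈ U, ContMDiffAt (𝓘(ℝ, EG).prod 𝓘(ℝ, EB)) 𝓘(ℝ, Y) ∞
      (fun p : G × B ↦ f p.1 p.2) (k, φ.symm x)) {L : K → Y →L[ℝ] Y} (hL : Continuous L) :
    IsSmoothFamilyOn (EG × (Y →L[ℝ] Y)) (fun (k : K) x ↦ L k (f k (φ.symm x))) U := by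
  intro k₀ x₀ hx₀
  let χ := chartAt EG (k₀ : G)
  have hk₀ : (k₀ : G) ∈ χ.source := mem_chart_source EG _
  refine ⟨fun k ↦ (χ k, L k), fun q x ↦ q.2 (f (χ.symm q.1) (φ.symm x)), ?_, ?_, ?_⟩
  · exact (ContinuousAt.comp (f := Subtype.val) (χ.continuousAt hk₀)
      continuous_subtype_val.continuousAt).prodMk hL.continuousAt
  · refine ContDiffAt.clm_apply (by fun_prop) ?_
    rw [← contMDiffAt_iff_contDiffAt]
    have h1 : ContMDiffAt 𝓘(ℝ, (EG × (Y →L[ℝ] Y)) × EB) 𝓘(ℝ, EG) ∞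
        (fun p : (EG × (Y →L[ℝ] Y)) × EB ↦ χ.symm p.1.1) ((χ k₀, L k₀), x₀) :=
      ContMDiffAt.comp (g := χ.symm) (f := fun p : (EG × (Y →L[ℝ] Y)) × EB ↦ p.1.1)
        ((χ k₀, L k₀), x₀)
        (contMDiffAt_symm_of_mem_maximalAtlas (IsManifold.chart_mem_maximalAtlas _)
          (χ.map_source hk₀)) (ContDiffAt.contMDiffAt (by fun_prop))
    have h2 : ContMDiffAt 𝓘(ℝ, (EG × (Y →L[ℝ] Y)) × EB) 𝓘(ℝ, EB) ∞
        (fun p : (EG × (Y →L[ℝ] Y)) × EB ↦ φ.symm p.2) ((χ k₀, L k₀), x₀) :=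
      ContMDiffAt.comp (g := φ.symm) (f := fun p : (EG × (Y →L[ℝ] Y)) × EB ↦ p.2)
        ((χ k₀, L k₀), x₀)
        (contMDiffAt_symm_of_mem_maximalAtlas hφ (hU hx₀)) (ContDiffAt.contMDiffAt (by fun_prop))
    have h3 := hf k₀ k₀.2 x₀ hx₀
    refine ContMDiffAt.comp (g := fun p : G × B ↦ f p.1 p.2) ((χ k₀, L k₀), x₀) ?_ (h1.prodMk h2)
    simpa only [χ.left_inv hk₀] using h3
  · have : ∀ᶠ k : K in 𝓝 k₀, (k : G) ∈ χ.source :=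
      continuous_subtype_val.continuousAt.eventually (χ.open_source.eventually_mem hk₀)
    filter_upwards [(continuous_fst.tendsto (k₀, x₀)).eventually this] with p hp
    simp only [χ.left_inv hp]

theorem isClosed_stabilizer (EG EB : Type*) [NormedAddCommGroup EG] [NormedSpace ℝ EG]
    {G : Type*} [TopologicalSpace G] [ChartedSpace EG G] [Group G]
    [NormedAddCommGroup EB] [NormedSpace ℝ EB]
    {B : Type*} [TopologicalSpace B] [ChartedSpace EB B] [T2Space B]
    [MulAction G B] [ContMDiffSMul 𝓘(ℝ, EG) 𝓘(ℝ, EB) ∞ G B] (x₀ : B) : IsClosed (MulAction.stabilizer G x₀ : Set G) := by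
  have := ContMDiffSMul.continuousSMul (I := 𝓘(ℝ, EG)) (I' := 𝓘(ℝ, EB)) (G := G) (M := B) ∞
  exact isClosed_eq (f := fun g : G ↦ g • x₀) (by fun_prop) continuous_const

theorem compactSpace_stabilizer (EG EB : Type*) [NormedAddCommGroup EG] [NormedSpace ℝ EG]
    {G : Type*} [TopologicalSpace G] [ChartedSpace EG G] [Group G] [CompactSpace G]
    [NormedAddCommGroup EB] [NormedSpace ℝ EB]
    {B : Type*} [TopologicalSpace B] [ChartedSpace EB B] [T2Space B]
    [MulAction G B] [ContMDiffSMul 𝓘(ℝ, EG) 𝓘(ℝ, EB) ∞ G B] (x₀ : B) : CompactSpace (MulAction.stabilizer G x₀) :=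
  isCompact_iff_compactSpace.1 (isClosed_stabilizer EG EB x₀).isCompact

/-- Bochner's argument: with `T k` the action of `k` in a chart and `D k` its derivative at the
fixed point, the average of `D k⁻¹ ∘ T k` intertwines the action with `D` and has derivative the
identity, so it is a change of coordinates. -/
theorem exists_linearizing_chart (EG : Type*) [NormedAddCommGroup EG] [NormedSpace ℝ EG]
    {G : Type*} [TopologicalSpace G] [ChartedSpace EG G] [Group G] [LieGroup 𝓘(ℝ, EG) ∞ G]
    [CompactSpace G]
    {EB : Type*} [NormedAddCommGroup EB] [NormedSpace ℝ EB] [FiniteDimensional ℝ EB]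
    {B : Type*} [TopologicalSpace B] [ChartedSpace EB B] [IsManifold 𝓘(ℝ, EB) ∞ B] [T2Space B]
    [MulAction G B] [ContMDiffSMul 𝓘(ℝ, EG) 𝓘(ℝ, EB) ∞ G B] (x₀ : B) :
    ∃ (φ : OpenPartialHomeomorph B EB) (D : MulAction.stabilizer G x₀ →* (EB →L[ℝ] EB)),
      φ ∈ IsManifold.maximalAtlas 𝓘(ℝ, EB) ∞ B ∧ x₀ ∈ φ.source ∧ φ x₀ = 0 ∧ Continuous D ∧
      ∀ᶠ y in 𝓝 x₀, ∀ k : MulAction.stabilizer G x₀,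
        k • y ∈ φ.source ∧ φ (k • y) = D k (φ y) := by
  let K := MulAction.stabilizer G x₀
  have hKx (k : K) : k • x₀ = x₀ := k.2
  have : IsTopologicalGroup G := topologicalGroup_of_lieGroup 𝓘(ℝ, EG) ∞
  have := ContMDiffSMul.continuousSMul (I := 𝓘(ℝ, EG)) (I' := 𝓘(ℝ, EB)) (G := G) (M := B) ∞
  have : CompactSpace K := compactSpace_stabilizer EG EB x₀
  let _ : MeasurableSpace K := borel K
  have : BorelSpace K := ⟨rfl⟩
  obtain ⟨μ, hμ, -, hμr⟩ := exists_isProbabilityMeasure_isMulRightInvariant K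
  let φ₀ := chartAt EB x₀
  have hφ₀ : φ₀ ∈ IsManifold.maximalAtlas 𝓘(ℝ, EB) ∞ B := IsManifold.chart_mem_maximalAtlas _
  have hx₀ : x₀ ∈ φ₀.source := mem_chart_source EB x₀
  let U₀ : Set B := {y | ∀ k : K, k • y ∈ φ₀.source}
  have hU₀ : IsOpen U₀ := isOpen_setOf_forall_smul_mem φ₀.open_source
  have hxU₀ : x₀ ∈ U₀ := fun k ↦ by rw [hKx]; exact hx₀
  have hU₀s {y : B} (hy : y ∈ U₀) : y ∈ φ₀.source := by simpa using hy 1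
  have hU₀K {y : B} (hy : y ∈ U₀) (k : K) : k • y ∈ U₀ := fun l ↦ by
    rw [← mul_smul]; exact hy _
  let U : Set EB := φ₀.target ∩ φ₀.symm ⁻¹' U₀
  have hU : IsOpen U := φ₀.symm.isOpen_inter_preimage hU₀
  let c := φ₀ x₀
  have hsymm_c : φ₀.symm c = x₀ := φ₀.left_inv hx₀
  have hcU : c ∈ U := ⟨φ₀.map_source hx₀, by rw [mem_preimage, hsymm_c]; exact hxU₀⟩
  let f : G → B → EB := fun g y ↦ φ₀ (g • y) - c
  have hf : ∀ k ∈ K, ∀ x ∈ U, ContMDiffAt (𝓘(ℝ, EG).prod 𝓘(ℝ, EB)) 𝓘(ℝ, EB) ∞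
      (fun p : G × B ↦ f p.1 p.2) (k, φ₀.symm x) := by
    intro k hk x hx
    refine ContMDiffAt.sub ?_ contMDiffAt_const
    exact ContMDiffAt.comp (g := φ₀) (f := fun p : G × B ↦ p.1 • p.2) (k, φ₀.symm x)
      (contMDiffAt_of_mem_maximalAtlas hφ₀ (hx.2 ⟨k, hk⟩))
      (contMDiff_smul (I := 𝓘(ℝ, EG)) (I' := 𝓘(ℝ, EB))).contMDiffAt
  let T : K → EB → EB := fun k x ↦ f k (φ₀.symm x)
  have hT : IsSmoothFamilyOn (EG × (EB →L[ℝ] EB)) T U :=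
    isSmoothFamilyOn_of_contMDiffAt EG hφ₀ inter_subset_left hf
      (L := fun _ ↦ ContinuousLinearMap.id ℝ EB) continuous_const
  have hTd (k : K) {x : EB} (hx : x ∈ U) : HasFDerivAt (T k) (fderiv ℝ (T k) x) x :=
    ((hT.contDiffAt k hx).differentiableAt (by simp)).hasFDerivAt
  have hT1 : fderiv ℝ (T 1) c = ContinuousLinearMap.id ℝ EB := by
    have : HasFDerivAt (T 1) (ContinuousLinearMap.id ℝ EB) c := by
      refine ((hasFDerivAt_id c).sub_const c).congr_of_eventuallyEq ?_
      filter_upwards [φ₀.open_target.eventually_mem hcU.1] with x hx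
      simp [T, f, φ₀.right_inv hx]
    exact this.fderiv
  -- Chain rule at the fixed point. The maps `T k` send `c` to `0`, hence the shift by `c` in the
  -- composition.
  have hTmul (k l : K) : fderiv ℝ (T (k * l)) c = (fderiv ℝ (T k) c).comp (fderiv ℝ (T l) c) := by
    have hTc : T l c + c = c := by
      have : (l : G) • x₀ = x₀ := hKx l
      simp only [T, f, hsymm_c, this]
      simp [c]
    have h1 : HasFDerivAt (fun x ↦ T k (T l x + c))
        ((fderiv ℝ (T k) c).comp (fderiv ℝ (T l) c)) c :=
      HasFDerivAt.comp (g := T k) (f := fun x ↦ T l x + c) c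
        (by simp only [hTc]; exact hTd k hcU) ((hTd l hcU).add_const c)
    refine (h1.congr_of_eventuallyEq ?_).fderiv
    filter_upwards [hU.eventually_mem hcU] with x hx
    have : φ₀.symm (φ₀ ((l : G) • φ₀.symm x)) = (l : G) • φ₀.symm x := φ₀.left_inv (hx.2 l)
    simp [T, f, this, mul_smul]
  let D : K →* (EB →L[ℝ] EB) :=
    { toFun := fun k ↦ fderiv ℝ (T k) c
      map_one' := hT1
      map_mul' := hTmul }
  have hDc : Continuous D := continuous_iff_continuousAt.2 fun k ↦
    ContinuousAt.comp (f := fun k ↦ (k, c)) (x := k) (hT.continuousAt_fderiv k hcU) (by fun_prop)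
  have hD' : Continuous fun k : K ↦ D k⁻¹ := hDc.comp continuous_inv
  have hS : IsSmoothFamilyOn (EG × (EB →L[ℝ] EB)) (fun k x ↦ D k⁻¹ (T k x)) U :=
    isSmoothFamilyOn_of_contMDiffAt EG hφ₀ inter_subset_left hf hD'
  let Φ : EB → EB := fun x ↦ ∫ k : K, D k⁻¹ (T k x) ∂μ
  have hΦd : HasFDerivAt Φ ((ContinuousLinearEquiv.refl ℝ EB : EB ≃L[ℝ] EB) : EB →L[ℝ] EB) c := by
    refine (hS.hasFDerivAt_integral hU μ hcU).congr_fderiv ?_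
    have (k : K) : fderiv ℝ (fun x ↦ D k⁻¹ (T k x)) c = ContinuousLinearMap.id ℝ EB := by
      have h1 : HasFDerivAt (fun x ↦ D k⁻¹ (T k x)) ((D k⁻¹).comp (D k)) c :=
        (D k⁻¹).hasFDerivAt.comp c (hTd k hcU)
      rw [h1.fderiv]
      have := map_mul D k⁻¹ k
      rw [inv_mul_cancel, map_one] at this
      exact this.symm
    simp only [this]
    simp
  have hΦc : Φ c = 0 := by
    have (k : K) : T k c = 0 := by
      have : (k : G) • x₀ = x₀ := hKx k
      simp only [T, f, hsymm_c, this]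
      simp [c]
    simp [Φ, this]
  have hΦK {y : B} (hy : y ∈ U₀) (k : K) : Φ (φ₀ (k • y)) = D k (Φ (φ₀ y)) := by
    have hyU : φ₀ y ∈ U := ⟨φ₀.map_source (hU₀s hy), by
      rw [mem_preimage, φ₀.left_inv (hU₀s hy)]; exact hy⟩
    have hint : Integrable (fun l ↦ D l⁻¹ (T l (φ₀ y))) μ :=
      (hS.continuous_left hyU).integrable_of_hasCompactSupport
        (HasCompactSupport.of_compactSpace _)
    have h1 : D k (∫ l : K, D l⁻¹ (T l (φ₀ y)) ∂μ) = ∫ l : K, D k (D l⁻¹ (T l (φ₀ y))) ∂μ :=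
      (ContinuousLinearMap.integral_comp_comm _ hint).symm
    simp only [Φ]
    rw [h1, ← integral_mul_right_eq_self (μ := μ) (fun l ↦ D k (D l⁻¹ (T l (φ₀ y)))) k]
    congr 1 with l
    rw [← mul_apply_eq_comp (D k), ← map_mul, mul_inv_rev, mul_inv_cancel_left]
    congr 1
    simp only [T, f, φ₀.left_inv (hU₀s hy), φ₀.left_inv (hU₀s (hU₀K hy k)), Subgroup.coe_mul,
      mul_smul]
    rfl
  obtain ⟨h, hch, hhU, hhΦ, hsymm, -⟩ := exists_openPartialHomeomorph_of_contDiffOn hU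
    (hS.contDiffOn_integral hU μ) hcU (ContinuousLinearEquiv.refl ℝ EB) hΦd
  have hxs : x₀ ∈ (φ₀.trans h).source := by
    rw [OpenPartialHomeomorph.trans_source]
    exact ⟨hx₀, hch⟩
  have hφx (y : B) : (φ₀.trans h) y = Φ (φ₀ y) := by
    rw [OpenPartialHomeomorph.coe_trans, hhΦ]; rfl
  refine ⟨φ₀.trans h, D, ?_, hxs, ?_, hDc, ?_⟩
  · refine OpenPartialHomeomorph.mem_maximalAtlas_of_contMDiffOn (I := 𝓘(ℝ, EB)) (n := ∞) _ ?_ ?_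
    · rw [OpenPartialHomeomorph.coe_trans]
      refine ContMDiffOn.comp (t := h.source) ?_
        ((contMDiffOn_of_mem_maximalAtlas hφ₀).mono fun y hy ↦ hy.1) (fun y hy ↦ hy.2)
      rw [contMDiffOn_iff_contDiffOn, hhΦ]
      exact (hS.contDiffOn_integral hU μ).mono hhU
    · rw [OpenPartialHomeomorph.coe_trans_symm]
      refine ContMDiffOn.comp (t := φ₀.target) (contMDiffOn_symm_of_mem_maximalAtlas hφ₀) ?_
        (fun y hy ↦ hy.2)
      rw [contMDiffOn_iff_contDiffOn]
      exact hsymm.mono fun y hy ↦ hy.1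
  · rw [hφx]; exact hΦc
  · have hW := isOpen_setOf_forall_smul_mem (K := K) (φ₀.trans h).open_source
    filter_upwards [hW.eventually_mem (x := x₀) (fun k ↦ by rw [hKx]; exact hxs),
      hU₀.eventually_mem hxU₀] with y hy hyU k
    exact ⟨hy k, by rw [hφx, hφx]; exact hΦK hyU k⟩

end Linearization

/-! ### The slice theorem -/

section Slice

open Topology Filter MeasureTheory Set

/-- A slice chart for a smooth action of a compact Lie group `G` around `x₀`: points `y` near `x₀`
are written `y = m y • s y` with `m y` and `s y` depending smoothly on `y` and the isotropy group of
`s y` contained in that of `x₀`; in the chart the condition that the two groups agree is linear. -/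
theorem exists_slice_chart (EG : Type*) [NormedAddCommGroup EG] [NormedSpace ℝ EG]
    [FiniteDimensional ℝ EG]
    {G : Type*} [TopologicalSpace G] [ChartedSpace EG G] [Group G] [LieGroup 𝓘(ℝ, EG) ∞ G]
    [CompactSpace G]
    {EB : Type*} [NormedAddCommGroup EB] [NormedSpace ℝ EB] [FiniteDimensional ℝ EB]
    {B : Type*} [TopologicalSpace B] [ChartedSpace EB B] [IsManifold 𝓘(ℝ, EB) ∞ B] [T2Space B]
    [MulAction G B] [ContMDiffSMul 𝓘(ℝ, EG) 𝓘(ℝ, EB) ∞ G B] (x₀ : B) {W : Set B}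
    (hW : W ∈ 𝓝 x₀) :
    ∃ (φ : OpenPartialHomeomorph B EB) (V : Submodule ℝ EB) (m : B → G) (s : B → B),
      φ ∈ IsManifold.maximalAtlas 𝓘(ℝ, EB) ∞ B ∧ x₀ ∈ φ.source ∧
      ContMDiffOn 𝓘(ℝ, EB) 𝓘(ℝ, EG) ∞ m φ.source ∧
      ContMDiffOn 𝓘(ℝ, EB) 𝓘(ℝ, EB) ∞ s φ.source ∧
      ∀ y ∈ φ.source, m y • s y = y ∧ s y ∈ W ∧
        MulAction.stabilizer G (s y) ≤ MulAction.stabilizer G x₀ ∧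
        (φ y ∈ V ↔ MulAction.stabilizer G x₀ ≤ MulAction.stabilizer G (s y)) := by
  let K := MulAction.stabilizer G x₀
  have hKx (k : K) : k • x₀ = x₀ := k.2
  have : IsTopologicalGroup G := topologicalGroup_of_lieGroup 𝓘(ℝ, EG) ∞
  have := ContMDiffSMul.continuousSMul (I := 𝓘(ℝ, EG)) (I' := 𝓘(ℝ, EB)) (G := G) (M := B) ∞
  have : CompactSpace K := compactSpace_stabilizer EG EB x₀
  obtain ⟨φ, D, hφ, hx₀, hφ0, hDc, hlin⟩ := exists_linearizing_chart EG (G := G) (EB := EB) x₀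
  have hsymm0 : φ.symm 0 = x₀ := by rw [← hφ0, φ.left_inv hx₀]
  have h0t : (0 : EB) ∈ φ.target := hφ0 ▸ φ.map_source hx₀
  have hφs : ContMDiffOn 𝓘(ℝ, EB) 𝓘(ℝ, EB) ∞ φ φ.source := contMDiffOn_of_mem_maximalAtlas hφ
  have hφt : ContMDiffOn 𝓘(ℝ, EB) 𝓘(ℝ, EB) ∞ φ.symm φ.target :=
    contMDiffOn_symm_of_mem_maximalAtlas hφ
  have hψc : ContinuousAt φ.symm 0 := φ.continuousAt_symm h0t
  -- a parametrization of `G` near the identity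
  let χ := chartAt EG (1 : G)
  have h1χ : (1 : G) ∈ χ.source := mem_chart_source EG _
  have hχ : χ ∈ IsManifold.maximalAtlas 𝓘(ℝ, EG) ∞ G := IsManifold.chart_mem_maximalAtlas _
  let γ : EG → G := fun x ↦ χ.symm (χ 1 + x)
  let Γ : Set EG := (fun x ↦ χ 1 + x) ⁻¹' χ.target
  have hΓ : IsOpen Γ := χ.open_target.preimage (by fun_prop)
  have h0Γ : (0 : EG) ∈ Γ := by simpa [Γ] using χ.map_source h1χ
  have hγ0 : γ 0 = 1 := by simp [γ, χ.left_inv h1χ]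
  have hγ : ContMDiffOn 𝓘(ℝ, EG) 𝓘(ℝ, EG) ∞ γ Γ :=
    (contMDiffOn_symm_of_mem_maximalAtlas hχ).comp
      (ContDiff.contMDiff (by fun_prop)).contMDiffOn (fun x hx ↦ hx)
  have hγa {x : EG} (hx : x ∈ Γ) : ContMDiffAt 𝓘(ℝ, EG) 𝓘(ℝ, EG) ∞ γ x :=
    hγ.contMDiffAt (hΓ.mem_nhds hx)
  have hγχ {g : G} (hg : g ∈ χ.source) : γ (χ g - χ 1) = g := by simp [γ, χ.left_inv hg]
  have hlog {f : EG → G} {x : EG} (hf : ContMDiffAt 𝓘(ℝ, EG) 𝓘(ℝ, EG) ∞ f x) (hfx : f x = 1) :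
      DifferentiableAt ℝ (fun x ↦ χ (f x) - χ 1) x ∧ ∀ᶠ x' in 𝓝 x, γ (χ (f x') - χ 1) = f x' := by
    constructor
    · have h1 : ContMDiffAt 𝓘(ℝ, EG) 𝓘(ℝ, EG) ∞ (fun x ↦ χ (f x)) x :=
        ContMDiffAt.comp (g := χ) (f := f) x
          (contMDiffAt_of_mem_maximalAtlas hχ (by rw [hfx]; exact h1χ)) hf
      exact ((contMDiffAt_iff_contDiffAt.1 h1).differentiableAt (by simp)).sub_const _
    · filter_upwards [hf.continuousAt.eventually (χ.open_source.eventually_mem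
        (show f x ∈ χ.source by rw [hfx]; exact h1χ))] with x' hx' using hγχ hx'
  -- the orbit map in coordinates
  let ℓ : EG → EB := fun x ↦ φ (γ x • x₀)
  have horb : ContMDiffOn 𝓘(ℝ, EG) 𝓘(ℝ, EB) ∞ (fun x ↦ γ x • x₀) Γ :=
    hγ.smul contMDiffOn_const
  let Λ : Set EG := Γ ∩ (fun x ↦ γ x • x₀) ⁻¹' φ.source
  have hΛ : IsOpen Λ := horb.continuousOn.isOpen_inter_preimage hΓ φ.open_source
  have h0Λ : (0 : EG) ∈ Λ := ⟨h0Γ, by simpa [hγ0] using hx₀⟩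
  have hℓ : ContDiffOn ℝ ∞ ℓ Λ := by
    rw [← contMDiffOn_iff_contDiffOn]
    exact hφs.comp (horb.mono inter_subset_left) fun x hx ↦ hx.2
  have hℓ0 : ℓ 0 = 0 := by simp [ℓ, hγ0, hφ0]
  let L := fderiv ℝ ℓ 0
  have hL : HasFDerivAt ℓ L 0 :=
    ((hℓ.contDiffAt (hΛ.mem_nhds h0Λ)).differentiableAt (by simp)).hasFDerivAt
  have horb0 : Tendsto (fun x ↦ γ x • x₀) (𝓝 0) (𝓝 x₀) := by
    have := (horb.contMDiffAt (hΓ.mem_nhds h0Γ)).continuousAt.tendsto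
    simpa [hγ0] using this
  let R : Submodule ℝ EB := LinearMap.range L.toLinearMap
  -- As `k` fixes `x₀`, translating the orbit by `k` amounts to conjugating the group element by
  -- `k`. Differentiating at the identity expresses `D k ∘ L` as `L` after the derivative of
  -- conjugation.
  have hRinv : ∀ k, ∀ v ∈ R, D k v ∈ R := by
    rintro k _ ⟨v, rfl⟩
    have hconj : ContMDiffAt 𝓘(ℝ, EG) 𝓘(ℝ, EG) ∞ (fun x ↦ (k : G) * γ x * (k : G)⁻¹) 0 :=
      (contMDiffAt_const.mul (hγa h0Γ)).mul contMDiffAt_const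
    obtain ⟨hβ, hβγ⟩ := hlog hconj (by simp [hγ0])
    have h1 : HasFDerivAt (fun x ↦ D k (ℓ x)) ((D k).comp L) 0 := (D k).hasFDerivAt.comp 0 hL
    have h2 : HasFDerivAt (fun x ↦ ℓ (χ ((k : G) * γ x * (k : G)⁻¹) - χ 1))
        (L.comp (fderiv ℝ (fun x ↦ χ ((k : G) * γ x * (k : G)⁻¹) - χ 1) 0)) 0 := by
      refine HasFDerivAt.comp (g := ℓ) 0 ?_ hβ.hasFDerivAt
      simpa [hγ0] using hL
    have h3 := h1.unique (h2.congr_of_eventuallyEq ?_)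
    · have := DFunLike.congr_fun h3 v
      simp only [ContinuousLinearMap.comp_apply] at this
      exact ⟨_, this.symm⟩
    · filter_upwards [hβγ, horb0.eventually hlin] with x hx hx'
      have h4 : (k : G)⁻¹ • x₀ = x₀ := inv_smul_eq_iff.2 (hKx k).symm
      simp only [ℓ]
      rw [hx, mul_smul, mul_smul, h4]
      exact (hx' k).2.symm
  obtain ⟨V, hRV, hVinv⟩ := CompactRep.exists_invariant_isCompl hDc R hRinv
  -- `ker L` plays the role of the Lie algebra of the isotropy group, and `M` that of a transversal
  -- to it.
  obtain ⟨M, hM⟩ := Submodule.exists_isCompl (LinearMap.ker L.toLinearMap)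
  have hMR : finrank ℝ M = finrank ℝ R := by
    have h1 := Submodule.finrank_add_eq_of_isCompl hM
    have h2 := LinearMap.finrank_range_add_finrank_ker L.toLinearMap
    simp only [R]
    omega
  -- the map `(a, v) ↦ γ a • v`, for `a ∈ M` and `v ∈ V`, in coordinates
  let P : M × V → B := fun p ↦ γ p.1 • φ.symm p.2
  let A : Set (M × V) := {p | (p.1 : EG) ∈ Γ ∧ (p.2 : EB) ∈ φ.target}
  have hA : IsOpen A := (hΓ.preimage (by fun_prop : Continuous fun p : M × V ↦ (p.1 : EG))).inter
    (φ.open_target.preimage (by fun_prop : Continuous fun p : M × V ↦ (p.2 : EB)))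
  have hP : ContMDiffOn 𝓘(ℝ, M × V) 𝓘(ℝ, EB) ∞ P A := by
    refine ContMDiffOn.smul (I := 𝓘(ℝ, EG)) (f := fun p : M × V ↦ γ p.1)
      (g := fun p : M × V ↦ φ.symm p.2) ?_ ?_
    · exact hγ.comp (ContDiff.contMDiff
        (M.subtypeL.contDiff.comp contDiff_fst)).contMDiffOn fun p hp ↦ hp.1
    · exact hφt.comp (ContDiff.contMDiff
        (V.subtypeL.contDiff.comp contDiff_snd)).contMDiffOn fun p hp ↦ hp.2
  let Φ : M × V → EB := fun p ↦ φ (P p)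
  let Ω : Set (M × V) := A ∩ P ⁻¹' φ.source
  have hΩ : IsOpen Ω := hP.continuousOn.isOpen_inter_preimage hA φ.open_source
  have hΦ : ContDiffOn ℝ ∞ Φ Ω := by
    rw [← contMDiffOn_iff_contDiffOn]
    exact hφs.comp (hP.mono inter_subset_left) fun x hx ↦ hx.2
  have h0Ω : (0 : M × V) ∈ Ω := by
    refine ⟨⟨by simpa using h0Γ, by simpa using h0t⟩, ?_⟩
    simpa [P, hγ0, hsymm0] using hx₀
  have hΦℓ (a : M) : Φ (a, 0) = ℓ a := by simp [Φ, P, ℓ, hsymm0]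
  have hΦV {v : V} (hv : (v : EB) ∈ φ.target) : Φ (0, v) = v := by
    simp [Φ, P, hγ0, φ.right_inv hv]
  have hΦ0 : Φ 0 = 0 :=
    (hΦℓ 0).trans (by simpa using hℓ0)
  let T : M × V →L[ℝ] EB := (L.comp M.subtypeL).coprod V.subtypeL
  have hT : HasFDerivAt Φ T 0 := by
    have h0 : HasFDerivAt Φ (fderiv ℝ Φ 0) 0 :=
      ((hΦ.contDiffAt (hΩ.mem_nhds h0Ω)).differentiableAt (by simp)).hasFDerivAt
    have e1 : (fderiv ℝ Φ 0).comp (ContinuousLinearMap.inl ℝ M V) = L.comp M.subtypeL := by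
      have h1 : HasFDerivAt (fun a : M ↦ Φ (a, 0))
          ((fderiv ℝ Φ 0).comp (ContinuousLinearMap.inl ℝ M V)) 0 :=
        HasFDerivAt.comp (g := Φ) (f := fun a : M ↦ (a, (0 : V))) 0 h0
          (hasFDerivAt_prodMk_left _ _)
      have h2 : HasFDerivAt (fun a : M ↦ Φ (a, 0)) (L.comp M.subtypeL) 0 := by
        simp only [hΦℓ]
        exact HasFDerivAt.comp (g := ℓ) (f := M.subtypeL) 0 (by simpa using hL)
          M.subtypeL.hasFDerivAt
      exact h1.unique h2
    have e2 : (fderiv ℝ Φ 0).comp (ContinuousLinearMap.inr ℝ M V) = V.subtypeL := by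
      have h1 : HasFDerivAt (fun v : V ↦ Φ (0, v))
          ((fderiv ℝ Φ 0).comp (ContinuousLinearMap.inr ℝ M V)) 0 :=
        HasFDerivAt.comp (g := Φ) (f := fun v : V ↦ ((0 : M), v)) 0 h0
          (hasFDerivAt_prodMk_right _ _)
      have h2 : HasFDerivAt (fun v : V ↦ Φ (0, v)) V.subtypeL 0 := by
        refine V.subtypeL.hasFDerivAt.congr_of_eventuallyEq ?_
        have : ∀ᶠ v : V in 𝓝 0, (v : EB) ∈ φ.target :=
          V.subtypeL.continuous.continuousAt.eventually
            (φ.open_target.eventually_mem (by simpa using h0t))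
        filter_upwards [this] with v hv using hΦV hv
      exact h1.unique h2
    refine h0.congr_fderiv ?_
    ext p
    · exact (DFunLike.congr_fun e1 p).trans (by simp [T])
    · exact (DFunLike.congr_fun e2 p).trans (by simp [T])
  have hTinj : Function.Injective T.toLinearMap := by
    rw [← LinearMap.ker_eq_bot, LinearMap.ker_eq_bot']
    rintro ⟨a, v⟩ hav
    have hav' : L a + v = 0 := hav
    have h1 : L a ∈ R := ⟨a, rfl⟩
    have h2 : L a ∈ V := by
      rw [eq_neg_of_add_eq_zero_left hav']
      exact V.neg_mem v.2
    have h3 : L a = 0 := (Submodule.disjoint_def.1 hRV.disjoint) _ h1 h2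
    have h4 : (a : EG) = 0 := (Submodule.disjoint_def.1 hM.disjoint) _ h3 a.2
    have h5 : (v : EB) = 0 := by simpa [h3] using hav'
    exact Prod.ext (Subtype.ext h4) (Subtype.ext h5)
  have hdim : finrank ℝ (M × V) = finrank ℝ EB := by
    rw [Module.finrank_prod, hMR, Submodule.finrank_add_eq_of_isCompl hRV]
  let Te : (M × V) ≃L[ℝ] EB :=
    (LinearEquiv.ofInjectiveOfFinrankEq T.toLinearMap hTinj hdim).toContinuousLinearEquiv
  have hTe : (Te : M × V →L[ℝ] EB) = T := by ext x <;> rfl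
  obtain ⟨h, h0h, hhΩ, hhΦ, hhsymm, -⟩ :=
    exists_openPartialHomeomorph_of_contDiffOn hΩ hΦ h0Ω Te (hTe ▸ hT)
  have h0ht : (0 : EB) ∈ h.target := by
    have := h.map_source h0h
    rwa [hhΦ, hΦ0] at this
  have hh0 : h.symm 0 = 0 := by
    have := h.left_inv h0h
    rwa [hhΦ, hΦ0] at this
  -- the orbit is locally `γ M • x₀`
  let w : EG → M × V := fun x ↦ h.symm (ℓ x)
  let Υ : Set EG := Λ ∩ ℓ ⁻¹' h.target
  have hΥ : IsOpen Υ := hℓ.continuousOn.isOpen_inter_preimage hΛ h.open_target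
  have h0Υ : (0 : EG) ∈ Υ := ⟨h0Λ, by rw [mem_preimage, hℓ0]; exact h0ht⟩
  have hw : ContDiffOn ℝ ∞ w Υ :=
    hhsymm.comp (hℓ.mono inter_subset_left) fun x hx ↦ hx.2
  have hwM : ∀ᶠ a : M in 𝓝 0, w a = (a, 0) := by
    have : ∀ᶠ a : M in 𝓝 0, (a, (0 : V)) ∈ h.source :=
      (Continuous.prodMk_left (0 : V)).continuousAt.eventually (h.open_source.eventually_mem h0h)
    filter_upwards [this] with a ha
    have := h.left_inv ha
    rwa [hhΦ, hΦℓ] at this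
  -- Homogeneity: near `γ x` the orbit map is translation by `γ x` after the orbit map near the
  -- identity, so its derivative factors through `L`.
  have hrank : ∀ x ∈ Υ, finrank ℝ (LinearMap.range (fderiv ℝ w x).toLinearMap) ≤ finrank ℝ M := by
    intro x hx
    have hmul : ContMDiffAt 𝓘(ℝ, EG) 𝓘(ℝ, EG) ∞ (fun x' ↦ (γ x)⁻¹ * γ x') x :=
      contMDiffAt_const.mul (hγa hx.1.1)
    obtain ⟨hβ, hβγ⟩ := hlog hmul (by simp)
    let α : EB → M × V := fun z ↦ h.symm (φ (γ x • φ.symm z))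
    have hα : DifferentiableAt ℝ α 0 := by
      have h1 : ContMDiffAt 𝓘(ℝ, EB) 𝓘(ℝ, EB) ∞ (fun z ↦ γ x • φ.symm z) 0 :=
        ContMDiffAt.comp (g := fun y : B ↦ γ x • y) (f := φ.symm) 0
          (ContMDiffSMul.contMDiff_const_smul (I := 𝓘(ℝ, EG)) (γ x)).contMDiffAt
          (hφt.contMDiffAt (φ.open_target.mem_nhds h0t))
      have h2 : ContMDiffAt 𝓘(ℝ, EB) 𝓘(ℝ, EB) ∞ (fun z ↦ φ (γ x • φ.symm z)) 0 :=
        ContMDiffAt.comp (g := φ) (f := fun z ↦ γ x • φ.symm z) 0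
          (hφs.contMDiffAt (φ.open_source.mem_nhds (by rw [hsymm0]; exact hx.1.2))) h1
      refine DifferentiableAt.comp (g := h.symm) (f := fun z ↦ φ (γ x • φ.symm z)) 0 ?_
        ((contMDiffAt_iff_contDiffAt.1 h2).differentiableAt (by simp))
      refine (hhsymm.contDiffAt (h.open_target.mem_nhds ?_)).differentiableAt (by simp)
      rw [hsymm0]
      exact hx.2
    have hcomp : HasFDerivAt w (((fderiv ℝ α 0).comp L).comp
        (fderiv ℝ (fun x' ↦ χ ((γ x)⁻¹ * γ x') - χ 1) x)) x := by
      have hβ0 : χ ((γ x)⁻¹ * γ x) - χ 1 = 0 := by simp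
      have h1 : HasFDerivAt (fun z ↦ α (ℓ z)) ((fderiv ℝ α 0).comp L) 0 :=
        HasFDerivAt.comp (g := α) 0 (by rw [hℓ0]; exact hα.hasFDerivAt) hL
      have h2 := HasFDerivAt.comp (g := fun z ↦ α (ℓ z)) x (by rw [hβ0]; exact h1) hβ.hasFDerivAt
      refine h2.congr_of_eventuallyEq ?_
      have h3 : ∀ᶠ x' in 𝓝 x, ((γ x)⁻¹ * γ x') • x₀ ∈ φ.source := by
        have : ContinuousAt (fun x' ↦ ((γ x)⁻¹ * γ x') • x₀) x :=
          hmul.continuousAt.smul continuousAt_const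
        exact this.eventually (φ.open_source.eventually_mem (by simpa using hx₀))
      filter_upwards [hβγ, h3] with x' hx' hx''
      simp only [Function.comp_apply, w, α, ℓ]
      rw [hx', φ.left_inv hx'', ← mul_smul, mul_inv_cancel_left]
    rw [hcomp.fderiv, hMR]
    let C := fderiv ℝ (fun x' ↦ χ ((γ x)⁻¹ * γ x') - χ 1) x
    calc finrank ℝ (LinearMap.range (((fderiv ℝ α 0).comp L).comp C).toLinearMap)
        ≤ finrank ℝ (LinearMap.range ((fderiv ℝ α 0).comp L).toLinearMap) :=
          Submodule.finrank_mono (LinearMap.range_comp_le_range C.toLinearMap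
            ((fderiv ℝ α 0).comp L).toLinearMap)
      _ = finrank ℝ (R.map (fderiv ℝ α 0).toLinearMap) := by
          rw [← LinearMap.range_comp]; rfl
      _ ≤ finrank ℝ R := Submodule.finrank_map_le _ _
  have hsnd := eventually_snd_eq_zero_of_finrank_range_le hΥ h0Υ hw hwM hrank
  obtain ⟨m₀, hm₀, V₀, hV₀, hmV⟩ := mem_nhds_prod_iff.1 (h.open_source.mem_nhds h0h)
  -- Elements of `Q` are the products of some `γ a`, with `a ∈ m₀`, and an element of `K`. The rank
  -- argument shows that they fill a neighbourhood of `1`, and translation by `K` a neighbourhood of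
  -- each point of `K`.
  let Q : Set G := {g | ∃ a ∈ m₀, g • x₀ = γ (a : M) • x₀}
  have hQ1 : Q ∈ 𝓝 (1 : G) := by
    have hw0 : w 0 = 0 := by simp [w, hℓ0, hh0]
    have h1 : ∀ᶠ x in 𝓝 (0 : EG), (w x).1 ∈ m₀ := by
      have : ContinuousAt (fun x ↦ (w x).1) 0 :=
        ((hw.continuousOn.continuousAt (hΥ.mem_nhds h0Υ))).fst
      exact this.eventually (by simpa [hw0] using hm₀)
    have h2 : Tendsto (fun g ↦ χ g - χ 1) (𝓝 1) (𝓝 0) := by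
      have := (χ.continuousAt h1χ).tendsto.sub_const (χ 1)
      simpa using this
    filter_upwards [h2.eventually h1, h2.eventually hsnd, h2.eventually (hΥ.eventually_mem h0Υ),
      χ.open_source.eventually_mem h1χ] with g hg1 hg2 hg3 hg4
    refine ⟨_, hg1, ?_⟩
    set x := χ g - χ 1 with hx
    have hgx : γ x = g := hγχ hg4
    have hws : w x ∈ h.source := h.map_target hg3.2
    have e1 : Φ (w x) = ℓ x := by
      rw [← hhΦ]; exact h.right_inv hg3.2
    have e2 : w x = ((w x).1, 0) := Prod.ext rfl hg2
    have e3 : φ (γ ((w x).1 : EG) • x₀) = φ (γ x • x₀) := by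
      rw [e2, hΦℓ] at e1
      exact e1
    have e4 : γ ((w x).1 : EG) • x₀ ∈ φ.source := by
      have := (hhΩ hws).2
      rw [e2] at this
      simpa [P, hsymm0] using this
    rw [← hgx]
    exact (φ.injOn e4 hg3.1.2 e3).symm
  have hQK (k : G) (hk : k • x₀ = x₀) : Q ∈ 𝓝 k := by
    have h1 : Tendsto (fun g ↦ g * k⁻¹) (𝓝 k) (𝓝 1) := by
      have := (continuous_mul_const k⁻¹).tendsto k
      simpa using this
    filter_upwards [h1 hQ1] with g hg
    obtain ⟨a, ha, hag⟩ := hg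
    refine ⟨a, ha, ?_⟩
    rw [← hag, mul_smul, inv_smul_eq_iff.2 hk.symm]
  -- An element outside `K` moves `x₀`, hence it and its neighbours move all points near `x₀`;
  -- compactness of `G` makes this uniform.
  have hstab : ∀ᶠ y in 𝓝 x₀, ∀ g : G, g • y = y → g ∈ Q := by
    have := (isCompact_univ (X := G)).eventually_forall_of_forall_eventually (x₀ := x₀)
      (P := fun y g ↦ g • y = y → g ∈ Q) fun g _ ↦ by
        by_cases hg : g • x₀ = x₀
        · filter_upwards [(continuous_snd.tendsto (x₀, g)).eventually (hQK g hg)] with p hp _ using hp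
        · have hc : IsOpen {p : B × G | p.2 • p.1 = p.1}ᶜ :=
            (isClosed_eq (by fun_prop) continuous_fst).isOpen_compl
          have : ∀ᶠ p : B × G in 𝓝 (x₀, g), p.2 • p.1 ≠ p.1 := hc.eventually_mem hg
          filter_upwards [this] with p hp hp' using absurd hp' hp
    simpa using this
  -- shrinking the slice
  have hψV : Tendsto (fun v : V ↦ φ.symm v) (𝓝 0) (𝓝 x₀) := by
    have h1 : Tendsto (fun v : V ↦ (v : EB)) (𝓝 0) (𝓝 0) := by
      simpa using V.subtypeL.continuous.tendsto 0
    have h2 := hψc.tendsto.comp h1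
    rwa [hsymm0] at h2
  let DV : K → V → V := fun k v ↦ ⟨D k v, hVinv k v v.2⟩
  -- The whole `K`-orbit of `v` must stay where `h` is injective, since injectivity is later applied
  -- to `(a, DV k v)`.
  have hDV : ∀ᶠ v : V in 𝓝 0, ∀ k : K, DV k v ∈ V₀ := by
    have := (isCompact_univ (X := K)).eventually_forall_of_forall_eventually (x₀ := (0 : V))
      (P := fun v k ↦ DV k v ∈ V₀) fun k _ ↦ by
        have hc : Continuous fun p : V × K ↦ DV p.2 p.1 :=
          Continuous.subtype_mk ((hDc.comp continuous_snd).clm_apply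
            (continuous_subtype_val.comp continuous_fst)) _
        have h0 : DV k 0 = 0 := Subtype.ext (by simp [DV])
        exact hc.continuousAt.eventually (by simp only [h0]; exact hV₀)
    simpa using this
  have hVt : ∀ᶠ v : V in 𝓝 0, (v : EB) ∈ φ.target :=
    V.subtypeL.continuous.continuousAt.eventually
      (φ.open_target.eventually_mem (by simpa using h0t))
  obtain ⟨V₁, hV₁, hV₁o, h0V₁⟩ := eventually_nhds_iff.1 ((hψV.eventually hlin).and
    ((hψV.eventually hstab).and (hDV.and (hVt.and (Filter.Eventually.and hV₀ (hψV hW))))))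
  have hψD {v : V} (hv : v ∈ V₁) (k : K) :
      k • φ.symm v ∈ φ.source ∧ φ (k • φ.symm v) = D k v := by
    obtain ⟨hv1, -, -, hv4, -⟩ := hV₁ v hv
    have := hv1 k
    rwa [φ.right_inv hv4] at this
  -- If `g = γ a * k` fixes the slice point of `v`, then `Φ` takes the same value at `(a, D k v)`
  -- and `(0, v)`. Injectivity forces `a = 0`, so `g = k`.
  have hle {v : V} (hv : v ∈ V₁) : MulAction.stabilizer G (φ.symm (v : EB)) ≤ K := by
    obtain ⟨-, hv2, hv3, hv4, hv5, -⟩ := hV₁ v hv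
    intro g hg
    obtain ⟨a, ha, hga⟩ := hv2 g hg
    let k : K := ⟨(γ a)⁻¹ * g, by
      change ((γ a)⁻¹ * g) • x₀ = x₀
      rw [mul_smul, hga, inv_smul_smul]⟩
    have hgk : g = γ a * k := by simp [k]
    have hk : φ.symm (D k v) = k • φ.symm v := by
      rw [← (hψD hv k).2, φ.left_inv (hψD hv k).1]
    have e1 : Φ (a, DV k v) = v := by
      have : γ (a : EG) • (k • φ.symm (v : EB)) = φ.symm v := by
        have h1 : g • φ.symm (v : EB) = φ.symm v := hg
        rwa [hgk, mul_smul] at h1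
      simp only [Φ, P, DV]
      rw [hk, this, φ.right_inv hv4]
    have e2 : Φ (a, DV k v) = Φ (0, v) := by rw [e1, hΦV hv4]
    rw [← hhΦ] at e2
    have e3 := h.injOn (hmV ⟨ha, hv3 k⟩) (hmV (mk_mem_prod (mem_of_mem_nhds hm₀) hv5)) e2
    have ha0 : a = 0 := congrArg Prod.fst e3
    have : g = k := by rw [hgk, ha0]; simp [hγ0]
    rw [this]
    exact k.2
  let h₁ := h.restrOpen (univ ×ˢ V₁) (isOpen_univ.prod hV₁o)
  have hh₁s {p : M × V} (hp : p ∈ h₁.source) : p ∈ h.source ∧ p.2 ∈ V₁ := ⟨hp.1, hp.2.2⟩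
  have hh₁t {z : EB} (hz : z ∈ h₁.target) : z ∈ h.target ∧ (h.symm z).2 ∈ V₁ := by
    have h1 : h₁.symm z ∈ h₁.source := h₁.map_target hz
    refine ⟨?_, (hh₁s h1).2⟩
    rw [← h₁.right_inv hz]
    exact h.map_source h1.1
  have h0h₁ : (0 : M × V) ∈ h₁.source := ⟨h0h, mem_univ _, h0V₁⟩
  let φ' := (φ.trans h₁.symm).transHomeomorph Te.toHomeomorph
  have hφ's {y : B} (hy : y ∈ φ'.source) : y ∈ φ.source ∧ φ y ∈ h₁.target := by
    simpa [φ'] using hy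
  have hφ'y (y : B) : φ' y = Te (h.symm (φ y)) := rfl
  have hcoord : ContMDiffOn 𝓘(ℝ, EB) 𝓘(ℝ, M × V) ∞ (fun y ↦ h.symm (φ y)) φ'.source := by
    refine ContMDiffOn.comp (t := h.target) ?_ (hφs.mono fun y hy ↦ (hφ's hy).1)
      fun y hy ↦ (hh₁t (hφ's hy).2).1
    rwa [contMDiffOn_iff_contDiffOn]
  have hcoordA {y : B} (hy : y ∈ φ'.source) : h.symm (φ y) ∈ Ω :=
    hhΩ (h.map_target (hh₁t (hφ's hy).2).1)
  -- In the coordinates `(a, v)` the subspace consists of the pairs with `v` fixed by `K`. The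
  -- isomorphism `Te` only serves to make the chart take values in `EB`.
  refine ⟨φ', (CompactRep.fixed D).comap
      (V.subtype ∘ₗ LinearMap.snd ℝ M V ∘ₗ Te.symm.toLinearMap),
    fun y ↦ γ (h.symm (φ y)).1, fun y ↦ φ.symm (h.symm (φ y)).2, ?_, ?_, ?_, ?_, ?_⟩
  · refine OpenPartialHomeomorph.mem_maximalAtlas_of_contMDiffOn (I := 𝓘(ℝ, EB)) (n := ∞) _ ?_ ?_
    · exact (Te.contDiff.contMDiff.comp_contMDiffOn hcoord)
    · have h1 : ∀ z ∈ φ'.target, Te.symm z ∈ h.source := by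
        intro z hz
        have : Te.symm z ∈ (φ.trans h₁.symm).target := by simpa [φ'] using hz
        exact (hh₁s (by simpa using this.1)).1
      have h2 : ContMDiffOn 𝓘(ℝ, EB) 𝓘(ℝ, EB) ∞ (fun z ↦ P (Te.symm z)) φ'.target :=
        hP.comp Te.symm.contDiff.contMDiff.contMDiffOn fun z hz ↦ (hhΩ (h1 z hz)).1
      refine h2.congr fun z hz ↦ ?_
      have h3 : φ'.symm z = φ.symm (h (Te.symm z)) := rfl
      rw [h3, hhΦ]
      exact φ.left_inv (hhΩ (h1 z hz)).2
  · simp only [φ', OpenPartialHomeomorph.transHomeomorph_source, OpenPartialHomeomorph.trans_source,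
      OpenPartialHomeomorph.symm_source, mem_inter_iff, mem_preimage, hφ0]
    refine ⟨hx₀, ?_⟩
    have := h₁.map_source h0h₁
    have e : h₁ 0 = Φ 0 := congrFun hhΦ 0
    rwa [e, hΦ0] at this
  · refine hγ.comp (ContMDiffOn.comp (t := univ) (I' := 𝓘(ℝ, M × V))
      (g := fun p : M × V ↦ (p.1 : EG)) (ContDiff.contMDiff
        (M.subtypeL.contDiff.comp contDiff_fst)).contMDiffOn hcoord fun _ _ ↦ mem_univ _)
        fun y hy ↦ (hcoordA hy).1.1
  · refine hφt.comp (ContMDiffOn.comp (t := univ) (I' := 𝓘(ℝ, M × V))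
      (g := fun p : M × V ↦ (p.2 : EB)) (ContDiff.contMDiff
        (V.subtypeL.contDiff.comp contDiff_snd)).contMDiffOn hcoord fun _ _ ↦ mem_univ _)
        fun y hy ↦ (hcoordA hy).1.2
  · intro y hy
    obtain ⟨hyt, hyV⟩ := hh₁t (hφ's hy).2
    refine ⟨?_, (hV₁ _ hyV).2.2.2.2.2, hle hyV, ?_⟩
    · refine φ.injOn (hcoordA hy).2 (hφ's hy).1 ?_
      change Φ (h.symm (φ y)) = φ y
      rw [← hhΦ]
      exact h.right_inv hyt
    · have e1 : φ' y ∈ (CompactRep.fixed D).comap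
          (V.subtype ∘ₗ LinearMap.snd ℝ M V ∘ₗ Te.symm.toLinearMap) ↔
          ∀ k : K, D k (h.symm (φ y)).2 = (h.symm (φ y)).2 := by
        rw [Submodule.mem_comap, hφ'y]
        have : (V.subtype ∘ₗ LinearMap.snd ℝ M V ∘ₗ Te.symm.toLinearMap) (Te (h.symm (φ y))) =
            (h.symm (φ y)).2 := by simp
        rw [this]
        rfl
      rw [e1]
      have hvt : ((h.symm (φ y)).2 : EB) ∈ φ.target := (hV₁ _ hyV).2.2.2.1
      constructor
      · intro hk g hg
        have h2 := hψD hyV ⟨g, hg⟩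
        rw [hk] at h2
        refine φ.injOn h2.1 (φ.map_target hvt) ?_
        rw [φ.right_inv hvt]
        exact h2.2
      · intro hk k
        have h2 := hψD hyV k
        have h3 : k • φ.symm ((h.symm (φ y)).2 : EB) = φ.symm (h.symm (φ y)).2 := hk k.2
        rw [← h2.2, h3, φ.right_inv hvt]

end Slice

/-! ### Smooth frames and the action in a trivialization -/

section Bundles

open Topology Filter MeasureTheory Set

theorem contMDiffOn_clm_of_apply {EN N F F' : Type*} [NormedAddCommGroup EN] [NormedSpace ℝ EN]
    {HN : Type*} [TopologicalSpace HN] {I : ModelWithCorners ℝ EN HN}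
    [TopologicalSpace N] [ChartedSpace HN N] [NormedAddCommGroup F] [NormedSpace ℝ F]
    [FiniteDimensional ℝ F] [NormedAddCommGroup F'] [NormedSpace ℝ F'] {f : N → F →L[ℝ] F'}
    {s : Set N} (hf : ∀ v, ContMDiffOn I 𝓘(ℝ, F') ∞ (fun x ↦ f x v) s) :
    ContMDiffOn I 𝓘(ℝ, F →L[ℝ] F') ∞ f s := by
  let d := finrank ℝ F
  have hd : d = finrank ℝ (Fin d → ℝ) := (finrank_fin_fun ℝ).symm
  let e₁ := ContinuousLinearEquiv.ofFinrankEq hd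
  let e₂ := (e₁.arrowCongr (1 : F' ≃L[ℝ] F')).trans (ContinuousLinearEquiv.piRing (Fin d))
  rw [← Function.id_comp f, ← e₂.symm_comp_self]
  exact e₂.symm.contDiff.contMDiff.comp_contMDiffOn (contMDiffOn_pi_space.2 fun i ↦ hf _)

variable {B F : Type*} {E : B → Type*} [∀ x, AddCommGroup (E x)] [∀ x, Module ℝ (E x)]
  [TopologicalSpace B] [TopologicalSpace (TotalSpace F E)] [NormedAddCommGroup F] [NormedSpace ℝ F]

section Trivialization

variable (e : Trivialization F (π F E))

theorem Bundle.Trivialization.exists_proj_eq_apply_snd_eq {y : B} (hy : y ∈ e.baseSet) (w : F) :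
    ∃ p : TotalSpace F E, p.proj = y ∧ (e p).2 = w :=
  ⟨e.toOpenPartialHomeomorph.symm (y, w), e.proj_symm_apply' hy, by
    rw [e.apply_symm_apply' hy]⟩

variable {EB : Type*} [NormedAddCommGroup EB] [NormedSpace ℝ EB] [ChartedSpace EB B]
  [∀ x, TopologicalSpace (E x)] [FiberBundle F E] [VectorBundle ℝ F E]
  [ContMDiffVectorBundle ∞ F E 𝓘(ℝ, EB)] [CompleteSpace F]

variable (EB) in
/-- Changing the frame of a smooth trivialization. -/
theorem exists_trivialization_of_frame [IsManifold 𝓘(ℝ, EB) ∞ B] [MemTrivializationAtlas e]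
    {O : Set B} (hO : IsOpen O)
    (hOe : O ⊆ e.baseSet) {A : B → F →L[ℝ] F} (hA : ContMDiffOn 𝓘(ℝ, EB) 𝓘(ℝ, F →L[ℝ] F) ∞ A O)
    (hAinv : ∀ y ∈ O, ∃ c : F ≃L[ℝ] F, (c : F →L[ℝ] F) = A y) :
    ∃ e' : Trivialization F (π F E), e'.baseSet = O ∧ e'.IsLinear ℝ ∧
      ContMDiffOn (𝓘(ℝ, EB).prod 𝓘(ℝ, F)) (𝓘(ℝ, EB).prod 𝓘(ℝ, F)) ∞ e' e'.source ∧
      ContMDiffOn (𝓘(ℝ, EB).prod 𝓘(ℝ, F)) (𝓘(ℝ, EB).prod 𝓘(ℝ, F)) ∞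
        e'.toOpenPartialHomeomorph.symm e'.target ∧
      ∀ p, (e' p).2 = A p.proj (e p).2 ∨ p.proj ∉ O := by
  classical
  -- The identity outside `O` is a dummy value.
  let c : B → F ≃L[ℝ] F := fun y ↦ if hy : y ∈ O then (hAinv y hy).choose else
    ContinuousLinearEquiv.refl ℝ F
  have hc {y : B} (hy : y ∈ O) : (c y : F →L[ℝ] F) = A y := by
    simp only [c, dif_pos hy]
    exact (hAinv y hy).choose_spec
  have hcs : ContMDiffOn 𝓘(ℝ, EB) 𝓘(ℝ, F →L[ℝ] F) ∞ (fun y ↦ (c y : F →L[ℝ] F)) O :=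
    hA.congr fun y hy ↦ hc hy
  have hcs' : ContMDiffOn 𝓘(ℝ, EB) 𝓘(ℝ, F →L[ℝ] F) ∞ (fun y ↦ ((c y).symm : F →L[ℝ] F)) O := by
    have : (fun y ↦ ((c y).symm : F →L[ℝ] F)) =
        fun y ↦ ContinuousLinearMap.inverse (c y : F →L[ℝ] F) := by
      ext1 y; rw [ContinuousLinearMap.inverse_equiv]
    rw [this]
    intro y hy
    exact (contDiffAt_map_inverse (c y)).contMDiffAt.comp_contMDiffWithinAt y (hcs y hy)
  let f := FiberwiseLinear.openPartialHomeomorph c hO hcs.continuousOn hcs'.continuousOn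
  have hsrc : (e.toOpenPartialHomeomorph.trans f).source = (π F E) ⁻¹' O := by
    ext p
    have : p ∈ (e.toOpenPartialHomeomorph.trans f).source ↔ p ∈ e.source ∧ (e p).1 ∈ O := by
      simp [f, FiberwiseLinear.openPartialHomeomorph]
    rw [this, e.mem_source, mem_preimage]
    constructor
    · rintro ⟨h1, h2⟩
      rwa [e.coe_fst' h1] at h2
    · intro h
      exact ⟨hOe h, by rwa [e.coe_fst' (hOe h)]⟩
  have htgt : (e.toOpenPartialHomeomorph.trans f).target = O ×ˢ univ := by
    ext p
    have : p ∈ (e.toOpenPartialHomeomorph.trans f).target ↔ p.1 ∈ O ∧ p.1 ∈ e.baseSet := by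
      simp [f, FiberwiseLinear.openPartialHomeomorph,
        e.mem_target]
    rw [this]
    simp only [mem_prod, mem_univ, and_true]
    exact ⟨fun h ↦ h.1, fun h ↦ ⟨h, hOe h⟩⟩
  let e' : Trivialization F (π F E) :=
    { toOpenPartialHomeomorph := e.toOpenPartialHomeomorph.trans f
      baseSet := O
      open_baseSet := hO
      source_eq := hsrc
      target_eq := htgt
      proj_toFun := fun p hp ↦ by
        rw [hsrc] at hp
        exact e.coe_fst' (hOe hp) }
  have hfst {p : TotalSpace F E} (hp : p.proj ∈ O) : (e p).1 = p.proj := e.coe_fst' (hOe hp)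
  have he' {p : TotalSpace F E} (hp : p.proj ∈ O) : (e' p).2 = A p.proj (e p).2 := by
    have : (e' p).2 = c (e p).1 (e p).2 := rfl
    rw [this, hfst hp, ← hc hp]
    rfl
  refine ⟨e', rfl, ⟨fun y hy ↦ ?_⟩, ?_, ?_, fun p ↦ or_iff_not_imp_right.2 fun hp ↦
    he' (not_not.1 hp)⟩
  · have h1 := e.linear ℝ (hOe hy)
    have h2 : (fun v : E y ↦ (e' ⟨y, v⟩).2) = fun v : E y ↦ A y (e ⟨y, v⟩).2 :=
      funext fun v ↦ he' (p := ⟨y, v⟩) hy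
    rw [h2]
    exact ⟨fun v w ↦ by rw [h1.map_add, map_add], fun r v ↦ by rw [h1.map_smul, map_smul]⟩
  · have hse : (e' : Trivialization F (π F E)).source ⊆ e.source := fun p hp ↦ hp.1
    have h1 : ContMDiffOn (𝓘(ℝ, EB).prod 𝓘(ℝ, F)) (𝓘(ℝ, EB).prod 𝓘(ℝ, F)) ∞ e e'.source :=
      (e.contMDiffOn (n := ∞) (IB := 𝓘(ℝ, EB))).mono hse
    have h2 : ContMDiffOn (𝓘(ℝ, EB).prod 𝓘(ℝ, F)) 𝓘(ℝ, EB) ∞ (fun p ↦ (e p).1) e'.source :=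
      contMDiff_fst.comp_contMDiffOn h1
    have h3 : ContMDiffOn (𝓘(ℝ, EB).prod 𝓘(ℝ, F)) 𝓘(ℝ, F) ∞ (fun p ↦ (e p).2) e'.source :=
      contMDiff_snd.comp_contMDiffOn h1
    refine h2.prodMk ((hcs.comp h2 fun p hp ↦ ?_).clm_apply h3)
    rw [e'.source_eq] at hp
    rw [mem_preimage, hfst hp]
    exact hp
  · have h1 : ContMDiffOn (𝓘(ℝ, EB).prod 𝓘(ℝ, F)) (𝓘(ℝ, EB).prod 𝓘(ℝ, F)) ∞
        (fun q : B × F ↦ (q.1, (c q.1).symm q.2)) e'.target := by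
      refine contMDiffOn_fst.prodMk ((hcs'.comp contMDiffOn_fst fun q hq ↦ ?_).clm_apply
        contMDiffOn_snd)
      rw [e'.target_eq] at hq
      exact hq.1
    refine (e.contMDiffOn_symm (n := ∞) (IB := 𝓘(ℝ, EB))).comp h1 fun q hq ↦ ?_
    rw [e'.target_eq] at hq
    exact e.mem_target.2 (hOe hq.1)

end Trivialization

section CoordAction

variable {G : Type*} [Group G] [MulAction G B] [MulAction G (TotalSpace F E)]
  [IsFiberwiseLinearAction G F E] (e : Trivialization F (π F E)) [e.IsLinear ℝ]
  [FiniteDimensional ℝ F]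

theorem proj_smul (g : G) (p : TotalSpace F E) : (g • p).proj = g • p.proj := by
  obtain ⟨y, v⟩ := p
  rw [smul_mk_eq_fiberAction]

/-- The action on a vector bundle, in a linear trivialization. -/
noncomputable def coordAction (g : G) (y : B) : F →L[ℝ] F :=
  LinearMap.toContinuousLinearMap
    (e.linearMapAt ℝ (g • y) ∘ₗ fiberAction F E g y ∘ₗ e.symmₗ ℝ y)

/-- Both base points must lie in the base set: `linearMapAt` and `symmₗ` are zero elsewhere. -/
theorem coordAction_apply {g : G} {p : TotalSpace F E} (hp : p.proj ∈ e.baseSet)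
    (hg : g • p.proj ∈ e.baseSet) : coordAction e g p.proj (e p).2 = (e (g • p)).2 := by
  obtain ⟨y, v⟩ := p
  have h1 : e.symmₗ ℝ y (e ⟨y, v⟩).2 = v := by
    have := e.symmₗ_linearMapAt (R := ℝ) hp v
    rwa [e.coe_linearMapAt_of_mem hp] at this
  simp only [coordAction, LinearMap.coe_toContinuousLinearMap', LinearMap.comp_apply, h1,
    smul_mk_eq_fiberAction]
  rw [e.coe_linearMapAt_of_mem hg]

theorem coordAction_mul {g h : G} {y : B} (hy : y ∈ e.baseSet) (hhy : h • y ∈ e.baseSet)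
    (hghy : g • h • y ∈ e.baseSet) :
    coordAction e (g * h) y = (coordAction e g (h • y)).comp (coordAction e h y) := by
  ext w
  obtain ⟨p, rfl, rfl⟩ := e.exists_proj_eq_apply_snd_eq hy w
  rw [ContinuousLinearMap.comp_apply, coordAction_apply e hy (by rwa [mul_smul]),
    coordAction_apply e hy hhy]
  rw [← proj_smul] at hhy hghy ⊢
  rw [coordAction_apply e hhy hghy, mul_smul]

theorem coordAction_one {y : B} (hy : y ∈ e.baseSet) :
    coordAction e (1 : G) y = ContinuousLinearMap.id ℝ F := by
  ext w
  obtain ⟨p, rfl, rfl⟩ := e.exists_proj_eq_apply_snd_eq hy w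
  rw [coordAction_apply e hy (by rwa [one_smul]), one_smul]
  rfl

variable {EG : Type*} [NormedAddCommGroup EG] [NormedSpace ℝ EG] [TopologicalSpace G]
  [ChartedSpace EG G] {EB : Type*} [NormedAddCommGroup EB] [NormedSpace ℝ EB] [ChartedSpace EB B]
  [∀ x, TopologicalSpace (E x)] [FiberBundle F E] [VectorBundle ℝ F E]
  [ContMDiffVectorBundle ∞ F E 𝓘(ℝ, EB)] [MemTrivializationAtlas e]
  [ContMDiffSMul 𝓘(ℝ, EG) (𝓘(ℝ, EB).prod 𝓘(ℝ, F)) ∞ G (TotalSpace F E)]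

/-- Smoothness may be tested on each vector `w` of `F`, whose image is the fibre coordinate of `g`
applied to the point with coordinates `(y, w)`. -/
theorem contMDiffOn_coordAction :
    ContMDiffOn (𝓘(ℝ, EG).prod 𝓘(ℝ, EB)) 𝓘(ℝ, F →L[ℝ] F) ∞
      (fun p : G × B ↦ coordAction e p.1 p.2)
      {p | p.2 ∈ e.baseSet ∧ p.1 • p.2 ∈ e.baseSet} := by
  refine contMDiffOn_clm_of_apply fun w ↦ ?_
  have h1 : ContMDiffOn (𝓘(ℝ, EG).prod 𝓘(ℝ, EB)) (𝓘(ℝ, EB).prod 𝓘(ℝ, F)) ∞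
      (fun p : G × B ↦ e.toOpenPartialHomeomorph.symm (p.2, w))
      {p | p.2 ∈ e.baseSet ∧ p.1 • p.2 ∈ e.baseSet} :=
    (e.contMDiffOn_symm (n := ∞) (IB := 𝓘(ℝ, EB))).comp
      (contMDiffOn_snd.prodMk contMDiffOn_const) fun p hp ↦ e.mem_target.2 hp.1
  have h2 : ContMDiffOn (𝓘(ℝ, EG).prod 𝓘(ℝ, EB)) (𝓘(ℝ, EB).prod 𝓘(ℝ, F)) ∞
      (fun p : G × B ↦ p.1 • e.toOpenPartialHomeomorph.symm (p.2, w))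
      {p | p.2 ∈ e.baseSet ∧ p.1 • p.2 ∈ e.baseSet} :=
    ContMDiffOn.smul (I := 𝓘(ℝ, EG)) (f := fun p : G × B ↦ p.1) contMDiffOn_fst h1
  have h3 : ContMDiffOn (𝓘(ℝ, EG).prod 𝓘(ℝ, EB)) (𝓘(ℝ, EB).prod 𝓘(ℝ, F)) ∞
      (fun p : G × B ↦ e (p.1 • e.toOpenPartialHomeomorph.symm (p.2, w)))
      {p | p.2 ∈ e.baseSet ∧ p.1 • p.2 ∈ e.baseSet} :=
    (e.contMDiffOn (n := ∞) (IB := 𝓘(ℝ, EB))).comp h2 fun p hp ↦ by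
      rw [mem_preimage, e.mem_source, proj_smul, e.proj_symm_apply' hp.1]
      exact hp.2
  refine (contMDiff_snd.comp_contMDiffOn h3).congr fun p hp ↦ ?_
  have h4 : (e.toOpenPartialHomeomorph.symm (p.2, w)).proj = p.2 := e.proj_symm_apply' hp.1
  have h5 := coordAction_apply e (g := p.1) (p := e.toOpenPartialHomeomorph.symm (p.2, w))
    (by rw [h4]; exact hp.1) (by rw [h4]; exact hp.2)
  rw [h4, e.apply_symm_apply' hp.1] at h5
  exact h5

end CoordAction

end Bundles

/-! ### Orbit type strata and adapted trivializations -/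

section Strata

open Topology Filter MeasureTheory Set

theorem Subgroup.map_conj_map_conj {G : Type*} [Group G] (H : Subgroup G) (a b : G) :
    (H.map (MulAut.conj a).toMonoidHom).map (MulAut.conj b).toMonoidHom =
      H.map (MulAut.conj (b * a)).toMonoidHom := by
  rw [Subgroup.map_map]
  congr 1
  ext g
  simp [mul_assoc]

theorem smul_mem_orbitTypeStratum {G B : Type*} [Group G] [MulAction G B] {H : Subgroup G} {x : B}
    (hx : x ∈ orbitTypeStratum B H) (g : G) : g • x ∈ orbitTypeStratum B H := by
  obtain ⟨a, ha⟩ := hx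
  refine ⟨g * a, ?_⟩
  rw [MulAction.stabilizer_smul_eq_stabilizer_map_conj, ha, Subgroup.map_conj_map_conj]

/-- If the isotropy group of `z` is contained in that of a point `x` of the stratum, then `z` lies
in the stratum if and only if the two isotropy groups agree. -/
theorem mem_orbitTypeStratum_iff_le {G B : Type*} [Group G] [TopologicalSpace G]
    [IsTopologicalGroup G] [CompactSpace G] [MulAction G B] {H : Subgroup G} {x z : B}
    (hK : IsClosed (MulAction.stabilizer G x : Set G))
    (hx : x ∈ orbitTypeStratum B H) (hzx : MulAction.stabilizer G z ≤ MulAction.stabilizer G x) :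
    z ∈ orbitTypeStratum B H ↔ MulAction.stabilizer G x ≤ MulAction.stabilizer G z := by
  obtain ⟨a, ha⟩ := hx
  constructor
  · rintro ⟨b, hb⟩
    have h1 : MulAction.stabilizer G z =
        (MulAction.stabilizer G x).map (MulAut.conj (b * a⁻¹)).toMonoidHom := by
      rw [ha, Subgroup.map_conj_map_conj, hb, inv_mul_cancel_right]
    rw [h1] at hzx ⊢
    exact (Subgroup.map_conj_eq_of_le hK _ hzx).ge
  · intro h
    exact ⟨a, by rw [le_antisymm hzx h, ha]⟩

/-- Translation by `m y` preserves the orbit type, so only `s y` matters. Its isotropy group lies in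
that of `x`, and equality of the two is linear in a slice chart. -/
theorem isEmbeddedSubmanifold_orbitTypeStratum (EG EB : Type*) [NormedAddCommGroup EG]
    [NormedSpace ℝ EG] [FiniteDimensional ℝ EG]
    {G : Type*} [TopologicalSpace G] [ChartedSpace EG G] [Group G] [LieGroup 𝓘(ℝ, EG) ∞ G]
    [CompactSpace G] [NormedAddCommGroup EB] [NormedSpace ℝ EB] [FiniteDimensional ℝ EB]
    {B : Type*} [TopologicalSpace B] [ChartedSpace EB B] [IsManifold 𝓘(ℝ, EB) ∞ B] [T2Space B]
    [MulAction G B] [ContMDiffSMul 𝓘(ℝ, EG) 𝓘(ℝ, EB) ∞ G B] (H : Subgroup G) :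
    IsEmbeddedSubmanifold EB (orbitTypeStratum B H) := by
  intro x hx
  have : IsTopologicalGroup G := topologicalGroup_of_lieGroup 𝓘(ℝ, EG) ∞
  obtain ⟨φ, V, m, s, hφ, hxφ, -, -, h⟩ := exists_slice_chart EG (G := G) (EB := EB) x univ_mem
  refine ⟨φ, hφ, hxφ, V, fun y hy ↦ ?_⟩
  obtain ⟨hms, -, hle, hV⟩ := h y hy
  rw [hV, ← mem_orbitTypeStratum_iff_le (isClosed_stabilizer EG EB x) hx hle]
  refine ⟨fun hyS ↦ ?_, fun hs ↦ ?_⟩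
  · have := smul_mem_orbitTypeStratum hyS (m y)⁻¹
    rwa [inv_smul_eq_iff.2 hms.symm] at this
  · have := smul_mem_orbitTypeStratum hs (m y)
    rwa [hms] at this

/-- Near `x₀` a trivialization can be modified to intertwine the action of the isotropy group of
`x₀` with a linear representation on the model fibre, at all points fixed by that group. -/
theorem exists_equivariant_frame (EG EB : Type*) [NormedAddCommGroup EG]
    [NormedSpace ℝ EG] {G : Type*} [TopologicalSpace G] [ChartedSpace EG G] [Group G]
    [LieGroup 𝓘(ℝ, EG) ∞ G]
    [CompactSpace G] [NormedAddCommGroup EB] [NormedSpace ℝ EB] [FiniteDimensional ℝ EB]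
    {B : Type*} [TopologicalSpace B] [ChartedSpace EB B] [IsManifold 𝓘(ℝ, EB) ∞ B] [T2Space B]
    [MulAction G B] [ContMDiffSMul 𝓘(ℝ, EG) 𝓘(ℝ, EB) ∞ G B]
    {F : Type*} [NormedAddCommGroup F] [NormedSpace ℝ F] [FiniteDimensional ℝ F]
    {E : B → Type*} [∀ x, AddCommGroup (E x)] [∀ x, Module ℝ (E x)]
    [TopologicalSpace (TotalSpace F E)] [∀ x, TopologicalSpace (E x)]
    [FiberBundle F E] [VectorBundle ℝ F E] [ContMDiffVectorBundle ∞ F E 𝓘(ℝ, EB)]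
    [MulAction G (TotalSpace F E)]
    [ContMDiffSMul 𝓘(ℝ, EG) (𝓘(ℝ, EB).prod 𝓘(ℝ, F)) ∞ G (TotalSpace F E)]
    [IsFiberwiseLinearAction G F E]
    (e : Trivialization F (π F E)) [MemTrivializationAtlas e] {x₀ : B} (hx₀ : x₀ ∈ e.baseSet) :
    ∃ (ρ : MulAction.stabilizer G x₀ →* (F →L[ℝ] F)) (b : B → F →L[ℝ] F) (N : Set B),
      Continuous ρ ∧ IsOpen N ∧ x₀ ∈ N ∧ N ⊆ e.baseSet ∧
      ContMDiffOn 𝓘(ℝ, EB) 𝓘(ℝ, F →L[ℝ] F) ∞ b N ∧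
      (∀ z ∈ N, ∃ c : F ≃L[ℝ] F, (c : F →L[ℝ] F) = b z) ∧
      ∀ z ∈ N, ∀ k : MulAction.stabilizer G x₀, k • z = z →
        (b z).comp (coordAction e (k : G) z) = (ρ k).comp (b z) := by
  let K := MulAction.stabilizer G x₀
  have hKx (k : K) : (k : G) • x₀ = x₀ := k.2
  have : IsTopologicalGroup G := topologicalGroup_of_lieGroup 𝓘(ℝ, EG) ∞
  have := ContMDiffSMul.continuousSMul (I := 𝓘(ℝ, EG)) (I' := 𝓘(ℝ, EB)) (G := G) (M := B) ∞
  have : CompactSpace K := compactSpace_stabilizer EG EB x₀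
  let _ : MeasurableSpace K := borel K
  have : BorelSpace K := ⟨rfl⟩
  obtain ⟨μ, hμ, -, hμr⟩ := exists_isProbabilityMeasure_isMulRightInvariant K
  let φ₀ := chartAt EB x₀
  have hφ₀ : φ₀ ∈ IsManifold.maximalAtlas 𝓘(ℝ, EB) ∞ B := IsManifold.chart_mem_maximalAtlas _
  have hx₀s : x₀ ∈ φ₀.source := mem_chart_source EB x₀
  let U₀ : Set B := {y | ∀ k : K, k • y ∈ e.baseSet}
  have hU₀ : IsOpen U₀ := isOpen_setOf_forall_smul_mem e.open_baseSet
  have hxU₀ : x₀ ∈ U₀ := fun k ↦ (hKx k).symm ▸ hx₀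
  have hU₀s {y : B} (hy : y ∈ U₀) : y ∈ e.baseSet := by simpa using hy 1
  let U : Set EB := φ₀.target ∩ φ₀.symm ⁻¹' U₀
  have hU : IsOpen U := φ₀.symm.isOpen_inter_preimage hU₀
  have hφ₀U {y : B} (hy : y ∈ U₀) (hys : y ∈ φ₀.source) : φ₀ y ∈ U :=
    ⟨φ₀.map_source hys, by rw [mem_preimage, φ₀.left_inv hys]; exact hy⟩
  have hopen : IsOpen {p : G × B | p.2 ∈ e.baseSet ∧ p.1 • p.2 ∈ e.baseSet} :=
    (e.open_baseSet.preimage continuous_snd).inter (e.open_baseSet.preimage continuous_smul)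
  have hf : ∀ k ∈ K, ∀ x ∈ U, ContMDiffAt (𝓘(ℝ, EG).prod 𝓘(ℝ, EB)) 𝓘(ℝ, F →L[ℝ] F) ∞
      (fun p : G × B ↦ coordAction e p.1 p.2) (k, φ₀.symm x) := fun k hk x hx ↦
    (contMDiffOn_coordAction e).contMDiffAt (hopen.mem_nhds ⟨hU₀s hx.2, hx.2 ⟨k, hk⟩⟩)
  let T : K → EB → F →L[ℝ] F := fun k x ↦ coordAction e (k : G) (φ₀.symm x)
  have hT : IsSmoothFamilyOn (EG × ((F →L[ℝ] F) →L[ℝ] (F →L[ℝ] F))) T U :=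
    isSmoothFamilyOn_of_contMDiffAt EG hφ₀ inter_subset_left hf
      (L := fun _ ↦ ContinuousLinearMap.id ℝ _) continuous_const
  let ρ : K →* (F →L[ℝ] F) :=
    { toFun := fun k ↦ coordAction e (k : G) x₀
      map_one' := coordAction_one e hx₀
      map_mul' := fun k l ↦ by
        have h := coordAction_mul e (g := (k : G)) (h := (l : G)) hx₀ ((hKx l).symm ▸ hx₀)
          (by rw [hKx, hKx]; exact hx₀)
        rw [hKx] at h
        exact h }
  have hρc : Continuous ρ := by
    have := hT.continuous_left (hφ₀U hxU₀ hx₀s)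
    simp only [T, φ₀.left_inv hx₀s] at this
    exact this
  let L : K → (F →L[ℝ] F) →L[ℝ] (F →L[ℝ] F) := fun k ↦ ContinuousLinearMap.compL ℝ F F F (ρ k⁻¹)
  have hL : Continuous L :=
    (ContinuousLinearMap.compL ℝ F F F).continuous.comp (hρc.comp continuous_inv)
  have hS : IsSmoothFamilyOn (EG × ((F →L[ℝ] F) →L[ℝ] (F →L[ℝ] F))) (fun k x ↦ L k (T k x)) U :=
    isSmoothFamilyOn_of_contMDiffAt EG hφ₀ inter_subset_left hf hL
  -- Average of the action of `k` from the fibre at `z` to that at `k • z`, followed by `ρ k⁻¹`. It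
  -- is the identity at `x₀`, hence invertible nearby, and an intertwiner wherever `k • z = z`.
  let b : B → F →L[ℝ] F := fun z ↦ ∫ k : K, L k (T k (φ₀ z)) ∂μ
  have hb : ContMDiffOn 𝓘(ℝ, EB) 𝓘(ℝ, F →L[ℝ] F) ∞ b (φ₀.source ∩ U₀) := by
    have h1 : ContMDiffOn 𝓘(ℝ, EB) 𝓘(ℝ, F →L[ℝ] F) ∞ (fun x ↦ ∫ k : K, L k (T k x) ∂μ) U := by
      rw [contMDiffOn_iff_contDiffOn]
      exact hS.contDiffOn_integral hU μ
    exact h1.comp ((contMDiffOn_of_mem_maximalAtlas hφ₀).mono inter_subset_left)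
      fun y hy ↦ hφ₀U hy.2 hy.1
  have hbx : b x₀ = ContinuousLinearMap.id ℝ F := by
    have h1 (k : K) : L k (T k (φ₀ x₀)) = ContinuousLinearMap.id ℝ F := by
      have := map_mul ρ k⁻¹ k
      rw [inv_mul_cancel, map_one] at this
      simp only [T, φ₀.left_inv hx₀s]
      exact this.symm
    simp [b, h1]
  have hbo : IsOpen (φ₀.source ∩ U₀ ∩ b ⁻¹' range ((↑) : (F ≃L[ℝ] F) → F →L[ℝ] F)) :=
    hb.continuousOn.isOpen_inter_preimage (φ₀.open_source.inter hU₀) ContinuousLinearEquiv.isOpen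
  refine ⟨ρ, b, _, hρc, hbo, ⟨⟨hx₀s, hxU₀⟩, ContinuousLinearEquiv.refl ℝ F, hbx.symm⟩,
    fun z hz ↦ hU₀s hz.1.2, hb.mono inter_subset_left, fun z hz ↦ hz.2, fun z hz k hk ↦ ?_⟩
  obtain ⟨⟨hzs, hzU⟩, -⟩ := hz
  have hint : Integrable (fun l ↦ L l (T l (φ₀ z))) μ :=
    (hS.continuous_left (hφ₀U hzU hzs)).integrable_of_hasCompactSupport
      (HasCompactSupport.of_compactSpace _)
  have hTz (l : K) : T l (φ₀ z) = coordAction e (l : G) z := by simp only [T, φ₀.left_inv hzs]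
  have h1 : (b z).comp (coordAction e (k : G) z) =
      ∫ l : K, (L l (T l (φ₀ z))).comp (coordAction e (k : G) z) ∂μ :=
    (ContinuousLinearMap.integral_comp_comm
      ((ContinuousLinearMap.compL ℝ F F F).flip (coordAction e (k : G) z)) hint).symm
  have h2 : (ρ k).comp (b z) = ∫ l : K, (ρ k).comp (L l (T l (φ₀ z))) ∂μ :=
    (ContinuousLinearMap.integral_comp_comm (ContinuousLinearMap.compL ℝ F F F (ρ k)) hint).symm
  rw [h1, h2, ← integral_mul_right_eq_self (μ := μ) (fun l ↦ (ρ k).comp (L l (T l (φ₀ z)))) k]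
  congr 1 with l : 1
  have hk' : (k : G) • z = z := hk
  have h3 := coordAction_mul e (g := (l : G)) (h := (k : G)) (hU₀s hzU) (hk'.symm ▸ hU₀s hzU)
    (by rw [hk']; exact hzU l)
  rw [hk'] at h3
  have h4 : (ρ k).comp (ρ (l * k)⁻¹) = ρ l⁻¹ := by
    have := map_mul ρ k (l * k)⁻¹
    rw [mul_inv_rev, mul_inv_cancel_left] at this
    rw [mul_inv_rev]
    exact this.symm
  have h5 : (ρ k).comp (L (l * k) (T (l * k) (φ₀ z))) =
      ((ρ k).comp (ρ (l * k)⁻¹)).comp (T (l * k) (φ₀ z)) := rfl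
  rw [h5, h4, hTz, hTz, Subgroup.coe_mul, h3]
  rfl

/-- Near a point `x₀` of an orbit type stratum there is a smooth trivialization which at all points
of the stratum intertwines the isotropy groups with one linear representation. -/
theorem exists_adapted_trivialization (EG EB : Type*) [NormedAddCommGroup EG]
    [NormedSpace ℝ EG] [FiniteDimensional ℝ EG]
    {G : Type*} [TopologicalSpace G] [ChartedSpace EG G] [Group G]
    [LieGroup 𝓘(ℝ, EG) ∞ G]
    [CompactSpace G] [NormedAddCommGroup EB] [NormedSpace ℝ EB] [FiniteDimensional ℝ EB]
    {B : Type*} [TopologicalSpace B] [ChartedSpace EB B] [IsManifold 𝓘(ℝ, EB) ∞ B] [T2Space B]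
    [MulAction G B] [ContMDiffSMul 𝓘(ℝ, EG) 𝓘(ℝ, EB) ∞ G B]
    (F : Type*) [NormedAddCommGroup F] [NormedSpace ℝ F] [FiniteDimensional ℝ F]
    (E : B → Type*) [∀ x, AddCommGroup (E x)] [∀ x, Module ℝ (E x)]
    [TopologicalSpace (TotalSpace F E)] [∀ x, TopologicalSpace (E x)]
    [FiberBundle F E] [VectorBundle ℝ F E] [ContMDiffVectorBundle ∞ F E 𝓘(ℝ, EB)]
    [MulAction G (TotalSpace F E)]
    [ContMDiffSMul 𝓘(ℝ, EG) (𝓘(ℝ, EB).prod 𝓘(ℝ, F)) ∞ G (TotalSpace F E)]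
    [IsFiberwiseLinearAction G F E] {H : Subgroup G} {x₀ : B} (hx₀ : x₀ ∈ orbitTypeStratum B H) :
    ∃ (e : Trivialization F (π F E)) (ρ : MulAction.stabilizer G x₀ →* (F →L[ℝ] F)),
      Continuous ρ ∧ x₀ ∈ e.baseSet ∧ e.IsLinear ℝ ∧
      ContMDiffOn (𝓘(ℝ, EB).prod 𝓘(ℝ, F)) (𝓘(ℝ, EB).prod 𝓘(ℝ, F)) ∞ e e.source ∧
      ContMDiffOn (𝓘(ℝ, EB).prod 𝓘(ℝ, F)) (𝓘(ℝ, EB).prod 𝓘(ℝ, F)) ∞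
        e.toOpenPartialHomeomorph.symm e.target ∧
      ∀ y ∈ orbitTypeStratum B H ∩ e.baseSet,
        ∃ κ : MulAction.stabilizer G y ≃ MulAction.stabilizer G x₀,
        ∀ (g : MulAction.stabilizer G y) (p : TotalSpace F E), p.proj = y →
          (e ((g : G) • p)).2 = ρ (κ g) (e p).2 := by
  have : IsTopologicalGroup G := topologicalGroup_of_lieGroup 𝓘(ℝ, EG) ∞
  let e₀ := trivializationAt F E x₀
  have hx₀e : x₀ ∈ e₀.baseSet := FiberBundle.mem_baseSet_trivializationAt' x₀
  obtain ⟨ρ, b, N, hρ, hN, hxN, hNe, hb, hbinv, hbρ⟩ :=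
    exists_equivariant_frame EG EB (G := G) e₀ hx₀e
  obtain ⟨φ, V, m, s, hφ, hxφ, hm, hs, h⟩ :=
    exists_slice_chart EG (G := G) (EB := EB) x₀ (hN.mem_nhds hxN)
  let O : Set B := φ.source ∩ e₀.baseSet
  have hO : IsOpen O := φ.open_source.inter e₀.open_baseSet
  have hms {y : B} (hy : y ∈ O) : (m y)⁻¹ • y = s y := inv_smul_eq_iff.2 (h y hy.1).1.symm
  have hsN {y : B} (hy : y ∈ O) : s y ∈ N := (h y hy.1).2.1
  -- The fibre at `y` is moved to the fibre at `s y`, where on the stratum the isotropy group is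
  -- that of `x₀`, and then straightened by the intertwiner.
  let A : B → F →L[ℝ] F := fun y ↦ (b (s y)).comp (coordAction e₀ (m y)⁻¹ y)
  have hA : ContMDiffOn 𝓘(ℝ, EB) 𝓘(ℝ, F →L[ℝ] F) ∞ A O := by
    refine ContMDiffOn.clm_comp ?_ ?_
    · exact hb.comp (hs.mono inter_subset_left) fun y hy ↦ hsN hy
    · exact (contMDiffOn_coordAction (EG := EG) (EB := EB) e₀).comp
        ((hm.mono inter_subset_left).inv.prodMk contMDiffOn_id)
        fun y hy ↦ ⟨hy.2, by simpa only [id, hms hy] using hNe (hsN hy)⟩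
  have hAinv : ∀ y ∈ O, ∃ c : F ≃L[ℝ] F, (c : F →L[ℝ] F) = A y := by
    intro y hy
    obtain ⟨c, hc⟩ := hbinv _ (hsN hy)
    have hms' : m y • s y = y := (h y hy.1).1
    have h1 := coordAction_mul e₀ (g := m y) (h := (m y)⁻¹) hy.2 (by rw [hms hy]; exact hNe (hsN hy))
      (by rw [smul_inv_smul]; exact hy.2)
    have h2 := coordAction_mul e₀ (g := (m y)⁻¹) (h := m y) (hNe (hsN hy)) (by rw [hms']; exact hy.2)
      (by rw [inv_smul_smul]; exact hNe (hsN hy))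
    rw [mul_inv_cancel, coordAction_one e₀ hy.2, hms hy] at h1
    rw [inv_mul_cancel, coordAction_one e₀ (hNe (hsN hy)), hms'] at h2
    let d : F ≃L[ℝ] F := ContinuousLinearEquiv.equivOfInverse (coordAction e₀ (m y)⁻¹ y)
      (coordAction e₀ (m y) (s y)) (fun v ↦ (DFunLike.congr_fun h1 v).symm)
      (fun v ↦ (DFunLike.congr_fun h2 v).symm)
    refine ⟨d.trans c, ?_⟩
    simp only [A]
    rw [← hc]
    rfl
  obtain ⟨e, heO, helin, hes, hes', heA⟩ := exists_trivialization_of_frame e₀ EB hO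
    inter_subset_right hA hAinv
  refine ⟨e, ρ, hρ, by rw [heO]; exact ⟨hxφ, hx₀e⟩, helin, hes, hes', ?_⟩
  rintro y ⟨hyS, hyO⟩
  rw [heO] at hyO
  obtain ⟨hms', -, hle, -⟩ := h y hyO.1
  have hstab : MulAction.stabilizer G (s y) = MulAction.stabilizer G x₀ := by
    refine le_antisymm hle ?_
    rw [← mem_orbitTypeStratum_iff_le (isClosed_stabilizer EG EB x₀) hx₀ hle, ← hms hyO]
    exact smul_mem_orbitTypeStratum hyS _
  have hmem (g : G) : g ∈ MulAction.stabilizer G y ↔ (m y)⁻¹ * g * m y ∈ MulAction.stabilizer G x₀ := by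
    rw [← hstab, MulAction.mem_stabilizer_iff, MulAction.mem_stabilizer_iff, mul_smul, hms',
      mul_smul, ← hms hyO, smul_left_cancel_iff]
  -- Conjugation by `(m y)⁻¹`. Only its bijectivity is recorded: fixed and moving subspaces depend
  -- just on the set of operators.
  let κ : MulAction.stabilizer G y ≃ MulAction.stabilizer G x₀ :=
    { toFun := fun g ↦ ⟨(m y)⁻¹ * g * m y, (hmem g).1 g.2⟩
      invFun := fun k ↦ ⟨m y * k * (m y)⁻¹, (hmem _).2 (by simp [mul_assoc])⟩
      left_inv := fun g ↦ Subtype.ext (by simp [mul_assoc])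
      right_inv := fun k ↦ Subtype.ext (by simp [mul_assoc]) }
  have heA' {p : TotalSpace F E} (hp : p.proj = y) :
      (e p).2 = b (s y) (e₀ ((m y)⁻¹ • p)).2 := by
    have h1 := (heA p).resolve_right (not_not.2 (hp ▸ hyO))
    rw [h1]
    subst hp
    simp only [A, ContinuousLinearMap.comp_apply]
    rw [coordAction_apply e₀ hyO.2 (by rw [hms hyO]; exact hNe (hsN hyO))]
  refine ⟨κ, fun g p hp ↦ ?_⟩
  have hgp : ((g : G) • p).proj = y := by rw [proj_smul, hp]; exact g.2
  have hks : (κ g) • s y = s y := by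
    have : ((κ g : MulAction.stabilizer G x₀) : G) ∈ MulAction.stabilizer G (s y) :=
      hstab.symm.le (κ g).2
    exact this
  have hks' : ((κ g : MulAction.stabilizer G x₀) : G) • s y = s y := hks
  have h1 : (m y)⁻¹ • (g : G) • p = ((κ g : MulAction.stabilizer G x₀) : G) • (m y)⁻¹ • p := by
    have : ((κ g : MulAction.stabilizer G x₀) : G) = (m y)⁻¹ * g * m y := rfl
    rw [this, ← mul_smul, ← mul_smul, mul_inv_cancel_right]
  have h2 : ((m y)⁻¹ • p).proj = s y := by rw [proj_smul, hp, hms hyO]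
  have h3 := coordAction_apply e₀ (g := ((κ g : MulAction.stabilizer G x₀) : G))
    (p := (m y)⁻¹ • p) (by rw [h2]; exact hNe (hsN hyO)) (by rw [h2, hks']; exact hNe (hsN hyO))
  rw [heA' hgp, heA' hp, h1, ← h3, h2]
  exact DFunLike.congr_fun (hbρ _ (hsN hyO) (κ g) hks) _

end Strata

/-! ### The canonical complement of the fixed subspace -/

section MovingSubspace

variable (G : Type*) {B : Type*} (F : Type*) (E : B → Type*)
  [Group G] [MulAction G B] [MulAction G (TotalSpace F E)]
  [∀ x, AddCommGroup (E x)] [∀ x, Module ℝ (E x)]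

/-- The subspace of the fibre `E x` spanned by the vectors `g v - v`, for `g` in the isotropy group
of `x`. -/
def movingSubspace (x : B) : Submodule ℝ (E x) :=
  Submodule.span ℝ {w | ∃ g ∈ MulAction.stabilizer G x, ∃ v v' : E x,
    g • (⟨x, v⟩ : TotalSpace F E) = ⟨x, v'⟩ ∧ v' - v = w}

variable [IsFiberwiseLinearAction G F E]

/-- `g` carries `h v - v` to `h' (g v) - g v`, where `h' = g * h * g⁻¹` fixes `g • x`. -/
theorem movingSubspace_le_comap (g : G) (x : B) :
    movingSubspace G F E x ≤ (movingSubspace G F E (g • x)).comap (fiberAction F E g x) := by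
  refine Submodule.span_le.2 ?_
  rintro _ ⟨h, hh, v, v', hv, rfl⟩
  refine Submodule.subset_span ⟨g * h * g⁻¹, ?_, fiberAction F E g x v, fiberAction F E g x v', ?_,
    (map_sub _ _ _).symm⟩
  · rw [MulAction.mem_stabilizer_iff] at hh ⊢
    rw [mul_smul, mul_smul, inv_smul_smul, hh]
  · rw [← smul_mk_eq_fiberAction, ← smul_mk_eq_fiberAction, mul_smul, mul_smul, inv_smul_smul, hv]

variable {G F E}

section Intertwining

variable {x : B} {K : Type*} [Group K] [NormedAddCommGroup F] [NormedSpace ℝ F]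
  [FiniteDimensional ℝ F] {ρ : K →* (F →L[ℝ] F)} {c : E x ≃ₗ[ℝ] F}
  {κ : MulAction.stabilizer G x ≃ K}

/-- The hypothesis names the image `v'` because the fibres over `g • x` and `x` are different types
even when the points are equal. -/
theorem fixedSubspace_eq_comap (hc : ∀ (g : MulAction.stabilizer G x) (v v' : E x),
      (g : G) • (⟨x, v⟩ : TotalSpace F E) = ⟨x, v'⟩ → c v' = ρ (κ g) (c v)) :
    fixedSubspace G F E x = (CompactRep.fixed ρ).comap c.toLinearMap := by
  ext v
  rw [mem_fixedSubspace_iff, Submodule.mem_comap]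
  constructor
  · intro hv k
    obtain ⟨g, rfl⟩ := κ.surjective k
    exact (hc g v v (hv g g.2)).symm
  · intro hv g hg
    obtain ⟨A, hA⟩ := exists_linearMap_of_smul_eq (F := F) (E := E)
      (MulAction.mem_stabilizer_iff.1 hg)
    have h1 := hc ⟨g, hg⟩ v (A v) (hA v)
    have h2 : ρ (κ ⟨g, hg⟩) (c v) = c v := hv _
    rw [h2] at h1
    rw [hA, c.injective h1]

theorem movingSubspace_eq_comap (hc : ∀ (g : MulAction.stabilizer G x) (v v' : E x),
      (g : G) • (⟨x, v⟩ : TotalSpace F E) = ⟨x, v'⟩ → c v' = ρ (κ g) (c v)) :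
    movingSubspace G F E x = (CompactRep.moving ρ).comap c.toLinearMap := by
  have hmap : (movingSubspace G F E x).map c.toLinearMap = CompactRep.moving ρ := by
    rw [movingSubspace, Submodule.map_span, CompactRep.moving]
    congr 1
    ext w
    constructor
    · rintro ⟨_, ⟨g, hg, v, v', hv, rfl⟩, rfl⟩
      refine ⟨κ ⟨g, hg⟩, c v, ?_⟩
      rw [← hc ⟨g, hg⟩ v v' hv]
      exact (map_sub c _ _).symm
    · rintro ⟨k, w, rfl⟩
      obtain ⟨⟨g, hg⟩, rfl⟩ := κ.surjective k
      obtain ⟨v, rfl⟩ := c.surjective w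
      obtain ⟨A, hA⟩ := exists_linearMap_of_smul_eq (F := F) (E := E)
        (MulAction.mem_stabilizer_iff.1 hg)
      refine ⟨A v - v, ⟨g, hg, v, A v, hA v, rfl⟩, ?_⟩
      rw [← hc ⟨g, hg⟩ v (A v) (hA v)]
      exact map_sub c _ _
  rw [← hmap, Submodule.comap_map_eq_of_injective c.injective]

end Intertwining

end MovingSubspace

/-! ### Splitting of the obstruction bundle -/

section Splitting

variable (G : Type*) {B : Type*} (F : Type*) (E : B → Type*)
  [Group G] [MulAction G B] [MulAction G (TotalSpace F E)]
  [∀ x, AddCommGroup (E x)] [∀ x, Module ℝ (E x)] [IsFiberwiseLinearAction G F E]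
  (hcompl : ∀ x, IsCompl (fixedSubspace G F E x) (movingSubspace G F E x))

/-- The splitting of the quotient map onto the obstruction fibre with image `movingSubspace`. -/
noncomputable def obstructionSplitting (x : B) : ObstructionFiber G F E x →ₗ[ℝ] E x :=
  (movingSubspace G F E x).subtype ∘ₗ
    (Submodule.quotientEquivOfIsCompl _ _ (hcompl x)).toLinearMap

theorem range_obstructionSplitting (x : B) :
    LinearMap.range (obstructionSplitting G F E hcompl x) = movingSubspace G F E x := by
  rw [obstructionSplitting, LinearMap.range_comp, LinearEquiv.range, Submodule.map_top,
    Submodule.range_subtype]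

theorem mkQ_obstructionSplitting (x : B) (q : ObstructionFiber G F E x) :
    (fixedSubspace G F E x).mkQ (obstructionSplitting G F E hcompl x q) = q :=
  Submodule.mk_quotientEquivOfIsCompl_apply (hcompl x) q

theorem obstructionSplitting_mkQ {x : B} {v : E x} (hv : v ∈ movingSubspace G F E x) :
    obstructionSplitting G F E hcompl x ((fixedSubspace G F E x).mkQ v) = v :=
  congrArg Subtype.val (Submodule.quotientEquivOfIsCompl_apply_mk_right (hcompl x) ⟨v, hv⟩)

/-- Both sides lie in the invariant moving subspace and have the same class in the quotient. -/
theorem fiberAction_obstructionSplitting (g : G) (x : B) (q : ObstructionFiber G F E x) :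
    fiberAction F E g x (obstructionSplitting G F E hcompl x q) =
      obstructionSplitting G F E hcompl (g • x) (obstructionAction F E g x q) := by
  have h1 : obstructionSplitting G F E hcompl x q ∈ movingSubspace G F E x :=
    (range_obstructionSplitting G F E hcompl x).le ⟨q, rfl⟩
  have h2 : obstructionAction F E g x q = (fixedSubspace G F E (g • x)).mkQ
      (fiberAction F E g x (obstructionSplitting G F E hcompl x q)) := by
    conv_lhs => rw [← mkQ_obstructionSplitting G F E hcompl x q]
    rfl
  rw [h2, obstructionSplitting_mkQ G F E hcompl (movingSubspace_le_comap G F E g x h1)]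

end Splitting

/-- A subbundle trivialization identifies all nearby `W y` with one `W₀`, so the dimension is
locally constant on `S`. -/
theorem finrank_eq_of_mem_connectedComponentIn {EB B F : Type*} {E : B → Type*}
    [NormedAddCommGroup EB] [NormedSpace ℝ EB] [TopologicalSpace B] [ChartedSpace EB B]
    [NormedAddCommGroup F] [NormedSpace ℝ F]
    [∀ x, AddCommGroup (E x)] [∀ x, Module ℝ (E x)]
    [TopologicalSpace (TotalSpace F E)] [∀ x, TopologicalSpace (E x)] [FiberBundle F E]
    {S : Set B} {W : ∀ x, Submodule ℝ (E x)} (hW : IsSmoothSubbundleOn EB F E S W) {x y : B}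
    (hx : x ∈ S) (hy : y ∈ connectedComponentIn S x) :
    finrank ℝ (W x) = finrank ℝ (W y) := by
  have hcont : ContinuousOn (fun x ↦ finrank ℝ (W x)) S := by
    intro z hz
    obtain ⟨e, W₀, hze, hlin, -, -, he⟩ := hW z hz
    have hfin {y : B} (hy : y ∈ S ∩ e.baseSet) : finrank ℝ (W y) = finrank ℝ W₀ := by
      have h1 : W y = W₀.comap (e.linearEquivAt ℝ y hy.2).toLinearMap :=
        Submodule.ext fun v ↦ he y hy v
      have h2 : (W y).map (e.linearEquivAt ℝ y hy.2).toLinearMap = W₀ := by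
        rw [h1]
        exact Submodule.map_comap_eq_of_surjective (e.linearEquivAt ℝ y hy.2).surjective _
      rw [← h2]
      exact (LinearEquiv.finrank_map_eq (e.linearEquivAt ℝ y hy.2) (W y)).symm
    refine (continuousWithinAt_const (b := finrank ℝ W₀)).congr_of_eventuallyEq ?_ (hfin ⟨hz, hze⟩)
    filter_upwards [inter_mem_nhdsWithin S (e.open_baseSet.mem_nhds hze)] with y hy using hfin hy
  exact isPreconnected_connectedComponentIn.constant
    (hcont.mono (connectedComponentIn_subset S x)) (mem_connectedComponentIn hx) hy

theorem proposition3p1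
    {EG : Type*} [NormedAddCommGroup EG] [NormedSpace ℝ EG] [FiniteDimensional ℝ EG]
    {G : Type*} [TopologicalSpace G] [ChartedSpace EG G] [Group G] [LieGroup 𝓘(ℝ, EG) ∞ G]
    [T2Space G] [CompactSpace G]
    {EB : Type*} [NormedAddCommGroup EB] [NormedSpace ℝ EB] [FiniteDimensional ℝ EB]
    {B : Type*} [TopologicalSpace B] [ChartedSpace EB B] [IsManifold 𝓘(ℝ, EB) ∞ B] [T2Space B]
    [MulAction G B] [ContMDiffSMul 𝓘(ℝ, EG) 𝓘(ℝ, EB) ∞ G B]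
    {F : Type*} [NormedAddCommGroup F] [NormedSpace ℝ F] [FiniteDimensional ℝ F]
    {E : B → Type*} [∀ x, AddCommGroup (E x)] [∀ x, Module ℝ (E x)]
    [TopologicalSpace (TotalSpace F E)] [∀ x, TopologicalSpace (E x)]
    [FiberBundle F E] [VectorBundle ℝ F E] [ContMDiffVectorBundle ∞ F E 𝓘(ℝ, EB)]
    [MulAction G (TotalSpace F E)]
    [ContMDiffSMul 𝓘(ℝ, EG) (𝓘(ℝ, EB).prod 𝓘(ℝ, F)) ∞ G (TotalSpace F E)]
    [IsFiberwiseLinearAction G F E]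
    (H : Subgroup G) (_hH : IsClosed (H : Set G)) :
    -- the dimension of the fixed space is constant on connected components of the stratum
    (∀ x ∈ orbitTypeStratum B H, ∀ y ∈ connectedComponentIn (orbitTypeStratum B H) x,
      finrank ℝ (fixedSubspace G F E x) = finrank ℝ (fixedSubspace G F E y)) ∧
    -- the stratum is a submanifold, over which the fixed spaces form a smooth `G`-subbundle
    IsEmbeddedSubmanifold EB (orbitTypeStratum B H) ∧
    IsSmoothGSubbundleOn G EB F E (orbitTypeStratum B H) (fixedSubspace G F E) ∧
    -- the quotient (obstruction) bundle is a complementary smooth `G`-bundle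
    (∃ σ : ∀ x, ObstructionFiber G F E x →ₗ[ℝ] E x,
      IsObstructionSplitting G EB F E (orbitTypeStratum B H) σ) := by
  have : IsTopologicalGroup G := topologicalGroup_of_lieGroup 𝓘(ℝ, EG) ∞
  have hcompl (x : B) : IsCompl (fixedSubspace G F E x) (movingSubspace G F E x) := by
    have : CompactSpace (MulAction.stabilizer G x) := compactSpace_stabilizer EG EB x
    -- Every point lies in the stratum of its own isotropy group. Complementarity thus holds over
    -- all of `B`, and the splitting is defined without reference to `H`.
    have hx : x ∈ orbitTypeStratum B (MulAction.stabilizer G x) :=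
      ⟨1, by rw [map_one]; exact (Subgroup.map_id _).symm⟩
    obtain ⟨e, ρ, hρ, hxe, hlin, -, -, h⟩ := exists_adapted_trivialization EG EB F E hx
    obtain ⟨κ, hκ⟩ := h x ⟨hx, hxe⟩
    let c := e.linearEquivAt ℝ x hxe
    have hc (g : MulAction.stabilizer G x) (v v' : E x)
        (hv : (g : G) • (⟨x, v⟩ : TotalSpace F E) = ⟨x, v'⟩) : c v' = ρ (κ g) (c v) := by
      have := hκ g ⟨x, v⟩ rfl
      rwa [hv] at this
    rw [fixedSubspace_eq_comap hc, movingSubspace_eq_comap hc]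
    exact (Submodule.orderIsoMapComap c).symm.isCompl (CompactRep.isCompl_fixed_moving hρ)
  have hsub : IsSmoothSubbundleOn EB F E (orbitTypeStratum B H) (fixedSubspace G F E) ∧
      IsSmoothSubbundleOn EB F E (orbitTypeStratum B H) (movingSubspace G F E) := by
    constructor
    all_goals
      intro x hx
      obtain ⟨e, ρ, hρ, hxe, hlin, hes, hes', h⟩ := exists_adapted_trivialization EG EB F E hx
    · refine ⟨e, CompactRep.fixed ρ, hxe, hlin, hes, hes', fun y hy v ↦ ?_⟩
      obtain ⟨κ, hκ⟩ := h y hy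
      rw [fixedSubspace_eq_comap (c := e.linearEquivAt ℝ y hy.2) (ρ := ρ) (κ := κ)]
      · rfl
      · intro g v v' hv
        have := hκ g ⟨y, v⟩ rfl
        rwa [hv] at this
    · refine ⟨e, CompactRep.moving ρ, hxe, hlin, hes, hes', fun y hy v ↦ ?_⟩
      obtain ⟨κ, hκ⟩ := h y hy
      rw [movingSubspace_eq_comap (c := e.linearEquivAt ℝ y hy.2) (ρ := ρ) (κ := κ)]
      · rfl
      · intro g v v' hv
        have := hκ g ⟨y, v⟩ rfl
        rwa [hv] at this
  have hinv (g : G) : ∀ x ∈ orbitTypeStratum B H, g • x ∈ orbitTypeStratum B H :=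
    fun x hx ↦ smul_mem_orbitTypeStratum hx g
  refine ⟨fun x hx y hy ↦ finrank_eq_of_mem_connectedComponentIn hsub.1 hx hy,
    isEmbeddedSubmanifold_orbitTypeStratum EG EB H,
    ⟨hinv, hsub.1, fun g x _ v hv ↦ fixedSubspace_le_comap G F E g x hv⟩,
    obstructionSplitting G F E hcompl, ?_⟩
  have hrange := range_obstructionSplitting G F E hcompl
  exact
    { mkQ_apply := fun x _ q ↦ mkQ_obstructionSplitting G F E hcompl x q
      equivariant := fun g x _ q ↦ fiberAction_obstructionSplitting G F E hcompl g x q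
      isCompl := fun x _ ↦ by rw [hrange]; exact hcompl x
      subbundle := by
        simp only [hrange]
        exact ⟨hinv, hsub.2, fun g x _ v hv ↦ movingSubspace_le_comap G F E g x hv⟩ }
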